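/- Let $M$ be the space of $C^\infty$ maps $u=(u^1,\dots,u^n):S^1=\mathbb R/\mathbb Z\to\mathbb R^n$; tangent vectors and covectors to $M$ are again smooth maps $S^1\to\mathbb R^n$, paired by $\langle v,\alpha\rangle=\int_{S^1}\sum_a v^a(x)\alpha_a(x)\,dx$. A differential polynomial is a polynomial in the derivatives $u_x,u_{xx},\dots$ with coefficients $C^\infty$ functions of $u\in\mathbb R^n$; its degree is computed by giving degree $0$ to functions of $u$ and degree $s$ to the $s$-th derivatives. A vector field $X$ on $M$ is homogeneous of degree $d$ if its components $X^a(u,u_x,\dots)$ are homogeneous differential polynomials of degree $d$. An operator field $P=P_u$ is homogeneous of degree $d$ if $P_u=\sum_{l=0}^{d}A_l\,\frac{d^{\,d-l}}{dx^{\,d-l}}$, where the entries of the $n\times n$ matrix $A_l$ are homogeneous differential polynomials of degree $l$. Bivectors are the skewsymmetric operator fields, $P_u^*=-P_u$. Write $F'_u(\varphi)=\frac{d}{ds}F(u+s\varphi)|_{s=0}$, $P'_u(\alpha;\varphi)=\frac{d}{ds}P_{u+s\varphi}\alpha|_{s=0}$, let $*$ denote the adjoint with respect to the pairing, and let $P_u'^{*}(\alpha;\beta)$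 be defined by $\langle P'_u(\alpha;\varphi),\beta\rangle=\langle\varphi,P_u'^{*}(\alpha;\beta)\rangle$ for all $\varphi$. The Lie derivative of a bivector along a vector field is $$(L_XP)_u\alpha=P'_u(\alpha;X(u))-X'_u(P_u\alpha)-P_u(X_u'^{*}\alpha),$$ and the Schouten bracket of two bivectors is given by $$2[P,Q](\alpha,\beta)=P'_u(\alpha;Q_u\beta)-P'_u(\beta;Q_u\alpha)+Q_uP_u'^{*}(\alpha;\beta)+Q'_u(\alpha;P_u\beta)-Q'_u(\beta;P_u\alpha)+P_uQ_u'^{*}(\alpha;\beta).$$ **Proposition.** Let $g=(g^{ab})$ be a constant, invertible, symmetric real $n\times n$ matrix (not necessarily positive definite) and $P_0=g\,\frac{d}{dx}$. Let $P_\epsilon=P_0+\epsilon P_1+\epsilon^2P_2+\cdots$ be a homogeneous formal deformation of $P_0$: each $P_k$ is skewsymmetric and homogeneous of degree $k+1$, and $[P_\epsilon,P_\epsilon]=0$ at every order in $\epsilon$, i.e. $\sum_{i+j=k}[P_i,P_j]=0$ for all $k\ge 0$. Then there is a sequence of vector fields $X_1,X_2,\dots$ on $M$, with $X_k$ homogeneous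 of degree $k$, such that for all $k\ge 0$ $$P_k=T_k(P_0),\qquad T_k=\sum_{j_1+2j_2+\cdots+kj_k=k}\frac{L_{X_k}^{j_k}}{j_k!}\cdots\frac{L_{X_1}^{j_1}}{j_1!},$$ where the sum is over non-negative integers $j_1,\dots,j_k$ and the operators are composed in the indicated order ($L_{X_1}$ acts first). -/

import Mathlib

open scoped ContDiff

/-! ## The loop space -/

/-- The manifold `M` of smooth maps `S¹ = ℝ/ℤ → ℝⁿ`, written as smooth `1`-periodic functions
on the line. Being a vector space, it is also the space of its tangent vectors at each of its
points, and (through the pairing below) the space of its (smooth) covectors. -/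
def Loop (n : ℕ) : Submodule ℝ (ℝ → Fin n → ℝ) where
  carrier := {u | ContDiff ℝ ∞ u ∧ Function.Periodic u 1}
  add_mem' := fun hu hv => ⟨hu.1.add hv.1, hu.2.add hv.2⟩
  zero_mem' := ⟨contDiff_const, fun _ => rfl⟩
  smul_mem' := fun c _ hu => ⟨contDiff_const.smul hu.1, fun x => by
    simp only [Pi.smul_apply]; rw [hu.2 x]⟩

/-- The pairing `⟨v, α⟩ = ∫_{S¹} ∑ₐ vᵃ(x) αₐ(x) dx` between tangent vectors and covectors. -/
noncomputable def loopPairing {n : ℕ} (v α : Loop n) : ℝ :=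
  ∫ x in (0 : ℝ)..1, ∑ a, v.1 x a * α.1 x a

/-- A vector field on `M`: the evolution `u̇ = X(u)`. -/
abbrev LoopVectorField (n : ℕ) : Type := Loop n → Loop n

/-- A field of operators `P_u : T*_u M → T_u M` on `M`; `P u α` is the value `P_u α`. -/
abbrev LoopOperator (n : ℕ) : Type := Loop n → Loop n → Loop n

/-! ## Fréchet derivatives, adjoints, Lie derivative, Schouten bracket -/

open Classical in
/-- The derivative `F'_u(φ) = d/ds F(u + s φ) |_{s = 0}` (which is unique when it exists). -/
noncomputable def loopDeriv {n : ℕ} (F : Loop n → Loop n) (u φ : Loop n) : Loop n :=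
  if h : ∃ w : Loop n, ∀ x : ℝ, HasDerivAt (fun s : ℝ => (F (u + s • φ)).1 x) (w.1 x) 0
  then h.choose else 0

open Classical in
/-- The adjoint `A*` of an operator `A`: `A* β` is the (unique) loop with
`⟨A φ, β⟩ = ⟨φ, A* β⟩` for all `φ`. -/
noncomputable def loopAdjoint {n : ℕ} (A : Loop n → Loop n) (β : Loop n) : Loop n :=
  if h : ∃ w : Loop n, ∀ φ : Loop n, loopPairing (A φ) β = loopPairing φ w
  then h.choose else 0

/-- The derivative `P'_u(α; φ)` of `P_u α` with respect to `u` along `φ`, at fixed `α`. -/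
noncomputable def operatorDeriv {n : ℕ} (P : LoopOperator n) (u α φ : Loop n) : Loop n :=
  loopDeriv (fun v => P v α) u φ

/-- The adjoint `P'_u*(α; β)` of `φ ↦ P'_u(α; φ)`, that is
`⟨P'_u(α; φ), β⟩ = ⟨φ, P'_u*(α; β)⟩`. -/
noncomputable def operatorDerivAdjoint {n : ℕ} (P : LoopOperator n) (u α β : Loop n) : Loop n :=
  loopAdjoint (operatorDeriv P u α) β

/-- `P` is skewsymmetric: `P_u* = - P_u`. -/
def IsSkew {n : ℕ} (P : LoopOperator n) : Prop :=
  ∀ u α β : Loop n, loopPairing (P u α) β = - loopPairing α (P u β)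

/-- The Lie derivative of a bivector along a vector field,
`(L_X P) α = P'(α; X) - X' (P α) - P (X'* α)`. -/
noncomputable def lieDerivative {n : ℕ} (X : LoopVectorField n) (P : LoopOperator n) :
    LoopOperator n := fun u α =>
  operatorDeriv P u α (X u) - loopDeriv X u (P u α) - P u (loopAdjoint (loopDeriv X u) α)

/-- The Schouten bracket of two bivectors (skewsymmetric operators), as a trivector with two
covector arguments and values in tangent vectors. For skewsymmetric `P` one has
`⟨[P,P](α,β), γ⟩ = ⟨P'(α; Pβ), γ⟩ + ⟨P'(β; Pγ), α⟩ + ⟨P'(γ; Pα), β⟩`. -/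
noncomputable def schoutenBracket {n : ℕ} (P Q : LoopOperator n) (u α β : Loop n) : Loop n :=
  (1 / 2 : ℝ) •
    (operatorDeriv P u α (Q u β) - operatorDeriv P u β (Q u α)
        + Q u (operatorDerivAdjoint P u α β)
      + operatorDeriv Q u α (P u β) - operatorDeriv Q u β (P u α)
        + P u (operatorDerivAdjoint Q u α β))

/-! ## Differential polynomials and homogeneity -/

/-- The algebra of smooth functions of `u ∈ ℝⁿ`. -/
def SmoothFun (n : ℕ) : Subalgebra ℝ ((Fin n → ℝ) → ℝ) where
  carrier := {f | ContDiff ℝ ∞ f}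
  mul_mem' := fun {f g} (hf : ContDiff ℝ ∞ f) (hg : ContDiff ℝ ∞ g) => hf.mul hg
  add_mem' := fun {f g} (hf : ContDiff ℝ ∞ f) (hg : ContDiff ℝ ∞ g) => hf.add hg
  algebraMap_mem' := fun c => (contDiff_const : ContDiff ℝ ∞ fun _ : Fin n → ℝ => c)

/-- Polynomials in the derivatives `u₁, u₂, …` of `u` with coefficients smooth functions of `u`;
the variable `(a, s)` stands for the derivative of order `s + 1` of the component `uᵃ`. -/
abbrev DiffPoly (n : ℕ) : Type := MvPolynomial (Fin n × ℕ) (SmoothFun n)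

/-- The value `f(u(x), u_x(x), u_xx(x), …)`. -/
noncomputable def DiffPoly.evalAt {n : ℕ} (f : DiffPoly n) (u : Loop n) (x : ℝ) : ℝ :=
  MvPolynomial.eval₂
    ((Pi.evalRingHom (fun _ : Fin n → ℝ => ℝ) (u.1 x)).comp
      (SmoothFun n).val.toRingHom)
    (fun p => iteratedDeriv (p.2 + 1) (fun y => u.1 y p.1) x) f

/-- `f` is homogeneous of degree `d`, where the functions of `u` have degree `0` and the
derivatives of order `s` have degree `s`. -/
def DiffPoly.IsHomogeneousOfDegree {n : ℕ} (f : DiffPoly n) (d : ℕ) : Prop :=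
  MvPolynomial.IsWeightedHomogeneous (fun p : Fin n × ℕ => p.2 + 1) f d

/-- `X` is homogeneous of degree `d`: its components are homogeneous differential polynomials
of degree `d`. -/
def IsHomogeneousVectorField {n : ℕ} (d : ℕ) (X : LoopVectorField n) : Prop :=
  ∃ f : Fin n → DiffPoly n, (∀ a, (f a).IsHomogeneousOfDegree d) ∧
    ∀ (u : Loop n) (x : ℝ) (a : Fin n), (X u).1 x a = (f a).evalAt u x

/-- `P` is homogeneous of degree `d`: it is a matrix differential operator
`P_u = ∑_{l ≤ d} A_l(u; u_x, …) dᵈ⁻ˡ/dxᵈ⁻ˡ` and the entries of `A_l` are homogeneous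
differential polynomials of degree `l`. -/
def IsHomogeneousOperator {n : ℕ} (d : ℕ) (P : LoopOperator n) : Prop :=
  ∃ A : ℕ → Matrix (Fin n) (Fin n) (DiffPoly n),
    (∀ l a b, (A l a b).IsHomogeneousOfDegree l) ∧
    ∀ (u α : Loop n) (x : ℝ) (a : Fin n),
      (P u α).1 x a = ∑ l ∈ Finset.range (d + 1), ∑ b,
        (A l a b).evalAt u x * iteratedDeriv (d - l) (fun y => α.1 y b) x

/-! ## The bivector of hydrodynamic type and its deformations -/

/-- The constant bivector of hydrodynamic type `P₀ = g d/dx`. -/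
noncomputable def hydrodynamicOperator {n : ℕ} (g : Matrix (Fin n) (Fin n) ℝ) :
    LoopOperator n := fun _ α =>
  ⟨fun x a => ∑ b, g a b * deriv (fun y => α.1 y b) x, by
    have hb : ∀ b, ContDiff ℝ ∞ (fun y => α.1 y b) := fun b => contDiff_pi.1 α.2.1 b
    refine ⟨contDiff_pi.2 fun a => ContDiff.sum fun b _ => contDiff_const.mul ?_, fun x => ?_⟩
    · exact (contDiff_infty_iff_deriv.1 (hb b)).2
    · funext a
      refine Finset.sum_congr rfl fun b _ => ?_
      rw [← deriv_comp_add_const]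
      congr 2
      funext y
      exact congrFun (α.2.2 y) b⟩

/-- `P = (P₀, P₁, P₂, …)` is the sequence of coefficients of a homogeneous formal deformation
`P_ε = ∑ εᵏ P_k` of `P₀ = g d/dx`: every `P_k` is skewsymmetric and homogeneous of degree `k + 1`,
and the Jacobi condition `[P_ε, P_ε] = 0` holds at every order in `ε`. -/
structure IsHomogeneousDeformation {n : ℕ} (g : Matrix (Fin n) (Fin n) ℝ)
    (P : ℕ → LoopOperator n) : Prop where
  zero : P 0 = hydrodynamicOperator g
  homogeneous : ∀ k, IsHomogeneousOperator (k + 1) (P k)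
  skew : ∀ k, IsSkew (P k)
  jacobi : ∀ k, ∑ p ∈ Finset.HasAntidiagonal.antidiagonal k, schoutenBracket (P p.1) (P p.2) = 0

/-! ## Schur polynomials of Lie derivatives -/

/-- `(L_{X_k}^{j_k} / j_k!) ⋯ (L_{X_1}^{j_1} / j_1!) P`, where `j_i` is stored as `j (i - 1)`. -/
noncomputable def lieMonomial {n : ℕ} (X : ℕ → LoopVectorField n) :
    (k : ℕ) → (Fin k → ℕ) → LoopOperator n → LoopOperator n
  | 0, _, P => P
  | k + 1, j, P =>
      ((Nat.factorial (j (Fin.last k)) : ℝ))⁻¹ •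
        (lieDerivative (X (k + 1)))^[j (Fin.last k)]
          (lieMonomial X k (fun i => j i.castSucc) P)

/-- `T_k = ∑_{j_1 + 2 j_2 + ⋯ + k j_k = k} (L_{X_k}^{j_k} / j_k!) ⋯ (L_{X_1}^{j_1} / j_1!)`
applied to `P`. (Every such `j_i` is at most `k`.) -/
noncomputable def schurOperator {n : ℕ} (X : ℕ → LoopVectorField n) (k : ℕ)
    (P : LoopOperator n) : LoopOperator n :=
  ∑ j ∈ (Fintype.piFinset fun _ : Fin k => Finset.range (k + 1)).filter
      (fun j => ∑ i : Fin k, ((i : ℕ) + 1) * j i = k),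
    lieMonomial X k j P

section

/-! ## Parametric integrals and mixed partial derivatives -/

theorem hasFDerivAt_integral_param {E F : Type} [NormedAddCommGroup E] [NormedSpace ℝ E]
    [ProperSpace E] [NormedAddCommGroup F] [NormedSpace ℝ F]
    {f : E × ℝ → F} (hf : ContDiff ℝ 1 f) (y : E) :
    HasFDerivAt (fun y => ∫ t in (0 : ℝ)..1, f (y, t))
      (∫ t in (0 : ℝ)..1, (fderiv ℝ f (y, t)).comp (ContinuousLinearMap.inl ℝ E ℝ)) y := by
  have hc : Continuous (fun p : E × ℝ => (fderiv ℝ f p).comp (ContinuousLinearMap.inl ℝ E ℝ)) :=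
    (hf.continuous_fderiv (by norm_num)).clm_comp continuous_const
  have hK : IsCompact (Metric.closedBall y 1 ×ˢ Set.Icc (0 : ℝ) 1) :=
    (isCompact_closedBall y 1).prod isCompact_Icc
  obtain ⟨C, hC⟩ := hK.exists_bound_of_continuousOn hc.continuousOn
  refine (intervalIntegral.hasFDerivAt_integral_of_dominated_of_fderiv_le (𝕜 := ℝ)
    (F := fun z t => f (z, t)) (bound := fun _ => C)
    (F' := fun z t => (fderiv ℝ f (z, t)).comp (ContinuousLinearMap.inl ℝ E ℝ))
    (Metric.ball_mem_nhds y one_pos) (Filter.Eventually.of_forall fun z => ?_) ?_ ?_ ?_ ?_ ?_)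
  · exact (hf.continuous.comp (by fun_prop : Continuous fun t : ℝ => (z, t))).aestronglyMeasurable
  · exact (hf.continuous.comp (by fun_prop : Continuous fun t : ℝ => (y, t))).intervalIntegrable _ _
  · exact (hc.comp (by fun_prop : Continuous fun t : ℝ => (y, t))).aestronglyMeasurable
  · refine Filter.Eventually.of_forall fun t ht z hz => hC (z, t) ⟨Metric.ball_subset_closedBall hz, ?_⟩
    rw [Set.uIoc_of_le zero_le_one] at ht
    exact ⟨ht.1.le, ht.2⟩
  · simp
  · refine Filter.Eventually.of_forall fun t _ z _ => ?_
    have h1 : HasFDerivAt (fun z : E => (z, t)) (ContinuousLinearMap.inl ℝ E ℝ) z :=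
      hasFDerivAt_prodMk_left z t
    exact ((hf.differentiable (by norm_num) (z, t)).hasFDerivAt).comp z h1

theorem contDiff_integral_param {E F : Type} [NormedAddCommGroup E] [NormedSpace ℝ E]
    [ProperSpace E] [NormedAddCommGroup F] [NormedSpace ℝ F]
    {f : E × ℝ → F} (hf : ContDiff ℝ ∞ f) :
    ContDiff ℝ ∞ (fun y => ∫ t in (0 : ℝ)..1, f (y, t)) := by
  rw [contDiff_infty]
  intro N
  induction N generalizing F with
  | zero =>
    exact contDiff_zero.2 (continuous_iff_continuousAt.2 fun y =>
      (hasFDerivAt_integral_param (hf.of_le (by exact_mod_cast le_top)) y).continuousAt)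
  | succ N ih =>
    have h := fun y => hasFDerivAt_integral_param (hf.of_le (by exact_mod_cast le_top)) y
    push_cast
    refine contDiff_succ_iff_fderiv.2 ⟨fun y => (h y).differentiableAt, by simp, ?_⟩
    have : fderiv ℝ (fun y => ∫ t in (0 : ℝ)..1, f (y, t)) = fun y =>
        ∫ t in (0 : ℝ)..1, (fderiv ℝ f (y, t)).comp (ContinuousLinearMap.inl ℝ E ℝ) :=
      funext fun y => (h y).fderiv
    rw [this]
    exact ih (f := fun p => (fderiv ℝ f p).comp (ContinuousLinearMap.inl ℝ E ℝ))
      (((contDiff_infty_iff_fderiv.1 hf).2).clm_comp contDiff_const)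

theorem hasDerivAt_integral_param {f : ℝ × ℝ → ℝ} (hf : ContDiff ℝ ∞ f) {f' : ℝ → ℝ} {y : ℝ}
    (hf' : ∀ t, HasDerivAt (fun s => f (s, t)) (f' t) y) :
    HasDerivAt (fun y => ∫ t in (0 : ℝ)..1, f (y, t)) (∫ t in (0 : ℝ)..1, f' t) y := by
  have hf1 : ContDiff ℝ 1 f := hf.of_le (by exact_mod_cast le_top)
  have h := (hasFDerivAt_integral_param hf1 y).hasDerivAt
  have hc : Continuous (fun t : ℝ => (fderiv ℝ f (y, t)).comp (ContinuousLinearMap.inl ℝ ℝ ℝ)) :=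
    ((hf1.continuous_fderiv (by norm_num)).comp (by fun_prop)).clm_comp continuous_const
  rw [ContinuousLinearMap.intervalIntegral_apply (hc.intervalIntegrable _ _)] at h
  have e : f' = fun t => ((fderiv ℝ f (y, t)).comp (ContinuousLinearMap.inl ℝ ℝ ℝ)) 1 := by
    funext t
    have h1 : HasFDerivAt (fun z : ℝ => (z, t)) (ContinuousLinearMap.inl ℝ ℝ ℝ) y :=
      hasFDerivAt_prodMk_left y t
    have h2 := (((hf1.differentiable (by norm_num) (y, t)).hasFDerivAt).comp y h1).hasDerivAt
    exact (hf' t).unique h2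
  rw [e]
  exact h

theorem ContDiff.deriv_fst {f : ℝ × ℝ → ℝ} (hf : ContDiff ℝ ∞ f) :
    ContDiff ℝ ∞ (fun p : ℝ × ℝ => deriv (fun s => f (s, p.2)) p.1) := by
  have : (fun p : ℝ × ℝ => deriv (fun s => f (s, p.2)) p.1) = fun p => fderiv ℝ f p (1, 0) := by
    funext p
    have h1 : HasFDerivAt (fun z : ℝ => (z, p.2)) (ContinuousLinearMap.inl ℝ ℝ ℝ) p.1 :=
      hasFDerivAt_prodMk_left _ _
    exact (((hf.differentiable (by simp) p).hasFDerivAt).comp p.1 h1).hasDerivAt.deriv.trans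
      (by simp)
  rw [this]
  exact (contDiff_infty_iff_fderiv.1 hf).2.clm_apply contDiff_const

theorem ContDiff.deriv_snd {f : ℝ × ℝ → ℝ} (hf : ContDiff ℝ ∞ f) :
    ContDiff ℝ ∞ (fun p : ℝ × ℝ => deriv (fun x => f (p.1, x)) p.2) := by
  have h := ContDiff.deriv_fst (hf.comp (contDiff_snd.prodMk contDiff_fst))
  exact h.comp (contDiff_snd.prodMk contDiff_fst)

theorem ContDiff.comp_mk_left {f : ℝ × ℝ → ℝ} (hf : ContDiff ℝ ∞ f) (x : ℝ) :
    ContDiff ℝ ∞ (fun s => f (s, x)) := hf.comp (contDiff_id.prodMk contDiff_const)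

theorem deriv_deriv_comm {f : ℝ × ℝ → ℝ} (hf : ContDiff ℝ ∞ f) (s x : ℝ) :
    deriv (fun s => deriv (fun x => f (s, x)) x) s =
      deriv (fun x => deriv (fun s => f (s, x)) s) x := by
  have hd := hf.differentiable (by simp)
  have hd2 : Differentiable ℝ (fderiv ℝ f) :=
    (contDiff_infty_iff_fderiv.1 hf).2.differentiable (by simp)
  have e1 : ∀ s x, deriv (fun x => f (s, x)) x = fderiv ℝ f (s, x) (0, 1) := fun s x =>
    ((hd (s, x)).hasFDerivAt.comp x (hasFDerivAt_prodMk_right s x)).hasDerivAt.deriv.trans (by simp)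
  have e2 : ∀ s x, deriv (fun s => f (s, x)) s = fderiv ℝ f (s, x) (1, 0) := fun s x =>
    ((hd (s, x)).hasFDerivAt.comp s (hasFDerivAt_prodMk_left s x)).hasDerivAt.deriv.trans (by simp)
  simp only [e1, e2]
  have a1 : HasFDerivAt (fun s => fderiv ℝ f (s, x)) _ s :=
    (hd2 (s, x)).hasFDerivAt.comp s (hasFDerivAt_prodMk_left s x)
  have a2 : HasFDerivAt (fun x => fderiv ℝ f (s, x)) _ x :=
    (hd2 (s, x)).hasFDerivAt.comp x (hasFDerivAt_prodMk_right s x)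
  have k1 := (a1.clm_apply (hasFDerivAt_const ((0 : ℝ), (1 : ℝ)) s)).hasDerivAt.deriv
  have k2 := (a2.clm_apply (hasFDerivAt_const ((1 : ℝ), (0 : ℝ)) x)).hasDerivAt.deriv
  refine Eq.trans k1 (Eq.trans ?_ k2.symm)
  have hs := second_derivative_symmetric (fun y => (hd y).hasFDerivAt) (hd2 (s, x)).hasFDerivAt
    (1, 0) (0, 1)
  simpa using hs

theorem ContDiff.iteratedDeriv_snd {f : ℝ × ℝ → ℝ} (hf : ContDiff ℝ ∞ f) (m : ℕ) :
    ContDiff ℝ ∞ (fun p : ℝ × ℝ => iteratedDeriv m (fun x => f (p.1, x)) p.2) := by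
  induction m generalizing f with
  | zero => simpa using hf
  | succ m ih => simpa only [iteratedDeriv_succ'] using ih hf.deriv_snd

theorem deriv_iteratedDeriv_comm {f : ℝ × ℝ → ℝ} (hf : ContDiff ℝ ∞ f) (m : ℕ) (s x : ℝ) :
    deriv (fun s => iteratedDeriv m (fun x => f (s, x)) x) s =
      iteratedDeriv m (fun x => deriv (fun s => f (s, x)) s) x := by
  induction m generalizing f with
  | zero => simp
  | succ m ih =>
    simp only [iteratedDeriv_succ']
    rw [ih hf.deriv_snd]
    congr 1
    funext y
    exact deriv_deriv_comm hf s y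

end

section

/-! ## Jets of loops -/

variable {n : ℕ}

/-- The derivative of order `s` of the component `uᵃ` at `x`. -/
noncomputable def jet (u : Loop n) (s : ℕ) (a : Fin n) (x : ℝ) : ℝ :=
  iteratedDeriv s (fun y => u.1 y a) x

theorem contDiff_coord (u : Loop n) (a : Fin n) : ContDiff ℝ ∞ (fun y => u.1 y a) :=
  contDiff_pi.1 u.2.1 a

theorem iteratedDeriv_contDiff {f : ℝ → ℝ} (hf : ContDiff ℝ ∞ f) (s : ℕ) :
    ContDiff ℝ ∞ (iteratedDeriv s f) := by
  induction s generalizing f with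
  | zero => simpa using hf
  | succ s ih => rw [iteratedDeriv_succ']; exact ih (contDiff_infty_iff_deriv.1 hf).2

theorem periodic_deriv {f : ℝ → ℝ} (hf : Function.Periodic f 1) :
    Function.Periodic (deriv f) 1 := fun x => by
  rw [← deriv_comp_add_const]; congr 1; funext y; exact hf y

theorem periodic_iteratedDeriv {f : ℝ → ℝ} (hf : Function.Periodic f 1) (s : ℕ) :
    Function.Periodic (iteratedDeriv s f) 1 := by
  induction s generalizing f with
  | zero => simpa using hf
  | succ s ih => rw [iteratedDeriv_succ']; exact ih (periodic_deriv hf)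

theorem contDiff_jet (u : Loop n) (s : ℕ) (a : Fin n) : ContDiff ℝ ∞ (jet u s a) :=
  iteratedDeriv_contDiff (contDiff_coord u a) s

theorem periodic_jet (u : Loop n) (s : ℕ) (a : Fin n) : Function.Periodic (jet u s a) 1 :=
  periodic_iteratedDeriv (fun x => congrFun (u.2.2 x) a) s

theorem deriv_jet (u : Loop n) (s : ℕ) (a : Fin n) : deriv (jet u s a) = jet u (s + 1) a := by
  funext x; rw [jet, iteratedDeriv_succ]; rfl

theorem hasDerivAt_jet (u : Loop n) (s : ℕ) (a : Fin n) (x : ℝ) :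
    HasDerivAt (jet u s a) (jet u (s + 1) a x) x := by
  rw [← deriv_jet]
  exact ((contDiff_jet u s a).differentiable (by simp) x).hasDerivAt

theorem jet_zero (u : Loop n) (a : Fin n) (x : ℝ) : jet u 0 a x = u.1 x a := by simp [jet]

theorem jet_add (u v : Loop n) (s : ℕ) (a : Fin n) (x : ℝ) :
    jet (u + v) s a x = jet u s a x + jet v s a x :=
  iteratedDeriv_fun_add ((contDiff_coord u a).of_le (by exact_mod_cast le_top)).contDiffAt
    ((contDiff_coord v a).of_le (by exact_mod_cast le_top)).contDiffAt

theorem jet_smul (c : ℝ) (u : Loop n) (s : ℕ) (a : Fin n) (x : ℝ) :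
    jet (c • u) s a x = c * jet u s a x :=
  iteratedDeriv_const_mul_field c _

/-- The loop given by a smooth periodic function (and `0` if the function is not such). -/
noncomputable def toLoop (f : ℝ → Fin n → ℝ) : Loop n :=
  open Classical in
  if h : ContDiff ℝ ∞ f ∧ Function.Periodic f 1 then ⟨f, h⟩ else 0

theorem toLoop_apply {f : ℝ → Fin n → ℝ} (h : ∀ a, ContDiff ℝ ∞ (fun x => f x a))
    (hp : ∀ a, Function.Periodic (fun x => f x a) 1) (x : ℝ) (a : Fin n) :
    (toLoop f).1 x a = f x a := by
  rw [toLoop, dif_pos ⟨contDiff_pi.2 h, fun x => funext fun a => hp a x⟩]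

theorem Loop.ext' {u v : Loop n} (h : ∀ x a, u.1 x a = v.1 x a) : u = v :=
  Subtype.ext (funext fun x => funext fun a => h x a)

@[simp] theorem Loop.add_val (u v : Loop n) (x : ℝ) (a : Fin n) :
    (u + v).1 x a = u.1 x a + v.1 x a := rfl
@[simp] theorem Loop.smul_val (c : ℝ) (u : Loop n) (x : ℝ) (a : Fin n) :
    (c • u).1 x a = c * u.1 x a := rfl
@[simp] theorem Loop.zero_val (x : ℝ) (a : Fin n) : (0 : Loop n).1 x a = 0 := rfl

/-- The constant loops. -/
def constLoop (c : Fin n → ℝ) : Loop n := ⟨fun _ => c, contDiff_const, fun _ => rfl⟩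

theorem jet_constLoop_zero (c : Fin n → ℝ) (a : Fin n) (x : ℝ) :
    jet (constLoop c) 0 a x = c a := jet_zero _ _ _

theorem jet_constLoop_succ (c : Fin n → ℝ) (s : ℕ) (a : Fin n) (x : ℝ) :
    jet (constLoop c) (s + 1) a x = 0 := by
  simp [jet, constLoop, iteratedDeriv_const]

theorem Loop.sum_val {ι : Type*} (s : Finset ι) (f : ι → Loop n) (x : ℝ) (a : Fin n) :
    (∑ i ∈ s, f i).1 x a = ∑ i ∈ s, (f i).1 x a := by
  classical
  induction s using Finset.induction_on with
  | empty => simp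
  | insert i s hi ih => simp [Finset.sum_insert hi, ih]

/-! ## Local densities -/

/-- Homogeneous differential polynomials, as functions of a loop and a point of the line. If `E`
holds, smooth periodic functions of the point are admitted as well, in every degree. -/
inductive Density (E : Prop) : ℕ → (Loop n → ℝ → ℝ) → Prop
  | coeff (c : (Fin n → ℝ) → ℝ) (hc : ContDiff ℝ ∞ c) : Density E 0 (fun u x => c (u.1 x))
  | jet (s : ℕ) (a : Fin n) : Density E (s + 1) (fun u x => jet u (s + 1) a x)
  | explicit (h : E) (d : ℕ) (κ : ℝ → ℝ) (hs : ContDiff ℝ ∞ κ) (hp : Function.Periodic κ 1) :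
      Density E d (fun _ x => κ x)
  | zero (d : ℕ) : Density E d (fun _ _ => 0)
  | add {d : ℕ} {f g : Loop n → ℝ → ℝ} (hf : Density E d f) (hg : Density E d g) :
      Density E d (fun u x => f u x + g u x)
  | mul {d e : ℕ} {f g : Loop n → ℝ → ℝ} (hf : Density E d f) (hg : Density E e g) :
      Density E (d + e) (fun u x => f u x * g u x)

namespace Density

variable {E : Prop} {d e : ℕ} {f g : Loop n → ℝ → ℝ}

theorem cast (hf : Density E d f) (h : d = e) : Density E e f := h ▸ hf

theorem congr (hf : Density E d f) (h : ∀ u x, f u x = g u x) : Density E d g := by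
  have : f = g := funext fun u => funext fun x => h u x
  exact this ▸ hf

theorem const (c : ℝ) : Density E 0 (fun (_ : Loop n) _ => c) := coeff (fun _ => c) contDiff_const

theorem const_mul (c : ℝ) (hf : Density E d f) : Density E d (fun u x => c * f u x) :=
  ((const c).mul hf).cast (zero_add d)

theorem neg (hf : Density E d f) : Density E d (fun u x => -f u x) :=
  (hf.const_mul (-1)).congr fun u x => by ring

theorem sub (hf : Density E d f) (hg : Density E d g) : Density E d (fun u x => f u x - g u x) :=
  (hf.add hg.neg).congr fun u x => by ring

theorem sum {ι : Type*} (s : Finset ι) {f : ι → Loop n → ℝ → ℝ}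
    (hf : ∀ i ∈ s, Density E d (f i)) : Density E d (fun u x => ∑ i ∈ s, f i u x) := by
  classical
  induction s using Finset.induction_on with
  | empty => simpa using Density.zero d
  | insert i s hi ih =>
    refine ((hf i (by simp)).add (ih fun j hj => hf j (by simp [hj]))).congr fun u x => ?_
    rw [Finset.sum_insert hi]

theorem jet' (s : ℕ) (a : Fin n) : Density E s (fun (u : Loop n) x => _root_.jet u s a x) := by
  cases s with
  | zero =>
    exact (coeff (fun y => y a) (by fun_prop)).congr fun u x => (jet_zero u a x).symm
  | succ s => exact jet s a

theorem mono {E' : Prop} (h : E → E') (hf : Density E d f) : Density E' d f := by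
  induction hf with
  | coeff c hc => exact coeff c hc
  | jet s a => exact jet s a
  | explicit hE d κ hs hp => exact explicit (h hE) d κ hs hp
  | zero d => exact zero d
  | add _ _ h1 h2 => exact h1.add h2
  | mul _ _ h1 h2 => exact h1.mul h2

theorem contDiff_comp (hf : Density E d f) {W : Type} [NormedAddCommGroup W] [NormedSpace ℝ W]
    {c : W → Loop n} {y : W → ℝ} (hy : ContDiff ℝ ∞ y)
    (hc : ∀ s a, ContDiff ℝ ∞ (fun p => _root_.jet (c p) s a (y p))) :
    ContDiff ℝ ∞ (fun p => f (c p) (y p)) := by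
  induction hf with
  | coeff b hb =>
    refine hb.comp (contDiff_pi.2 fun a => ?_)
    simpa only [jet_zero] using hc 0 a
  | jet s a => exact hc (s + 1) a
  | explicit hE d κ hs hp => exact hs.comp hy
  | zero d => exact contDiff_const
  | add _ _ h1 h2 => exact h1.add h2
  | mul _ _ h1 h2 => exact h1.mul h2

theorem contDiff (hf : Density E d f) (u : Loop n) : ContDiff ℝ ∞ (f u) :=
  hf.contDiff_comp (c := fun _ => u) (y := fun x => x) contDiff_id fun s a => contDiff_jet u s a

theorem contDiff_line (hf : Density E d f) (u φ : Loop n) :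
    ContDiff ℝ ∞ (fun p : ℝ × ℝ => f (u + p.1 • φ) p.2) :=
  hf.contDiff_comp (c := fun p : ℝ × ℝ => u + p.1 • φ) (y := fun p => p.2) contDiff_snd
    fun s a => by
    simp only [jet_add, jet_smul]
    exact ((contDiff_jet u s a).comp contDiff_snd).add
      (contDiff_fst.mul ((contDiff_jet φ s a).comp contDiff_snd))

theorem contDiff_plane (hf : Density E d f) (u φ ψ : Loop n) (x : ℝ) :
    ContDiff ℝ ∞ (fun p : ℝ × ℝ => f (u + p.1 • φ + p.2 • ψ) x) :=
  hf.contDiff_comp (c := fun p : ℝ × ℝ => u + p.1 • φ + p.2 • ψ) (y := fun _ => x) contDiff_const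
    fun s a => by
    simp only [jet_add, jet_smul]
    fun_prop

theorem contDiff_ray (hf : Density E d f) (u : Loop n) :
    ContDiff ℝ ∞ (fun p : ℝ × ℝ => f (p.1 • u) p.2) :=
  by simpa only [zero_add] using hf.contDiff_line 0 u

theorem periodic (hf : Density E d f) (u : Loop n) : Function.Periodic (f u) 1 := by
  induction hf with
  | coeff b hb => intro x; simp only [u.2.2 x]
  | jet s a => exact periodic_jet u (s + 1) a
  | explicit hE d κ hs hp => exact hp
  | zero d => intro x; rfl
  | add _ _ h1 h2 => exact h1.add h2
  | mul _ _ h1 h2 => exact h1.mul h2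

theorem hasDerivAt (hf : Density E d f) (u : Loop n) (x : ℝ) :
    HasDerivAt (f u) (deriv (f u) x) x :=
  ((hf.contDiff u).differentiable (by simp) x).hasDerivAt

/-- The partial derivatives of a smooth function of `u`. -/
theorem contDiff_partial {c : (Fin n → ℝ) → ℝ} (hc : ContDiff ℝ ∞ c) (a : Fin n) :
    ContDiff ℝ ∞ (fun y => fderiv ℝ c y (Pi.single a 1)) :=
  (contDiff_infty_iff_fderiv.1 hc).2.clm_apply contDiff_const

theorem hasDerivAt_coeff {c : (Fin n → ℝ) → ℝ} (hc : ContDiff ℝ ∞ c) {γ : ℝ → Fin n → ℝ}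
    {v : Fin n → ℝ} {t : ℝ} (h : ∀ a, HasDerivAt (fun s => γ s a) (v a) t) :
    HasDerivAt (fun s => c (γ s)) (∑ a, fderiv ℝ c (γ t) (Pi.single a 1) * v a) t := by
  have h1 := ((hc.differentiable (by simp) (γ t)).hasFDerivAt).comp_hasDerivAt t
    (hasDerivAt_pi.2 h)
  refine h1.congr_deriv ?_
  have hv : v = ∑ a, v a • (Pi.single a 1 : Fin n → ℝ) := by
    funext b; simp [Finset.sum_apply, Pi.single_apply]
  conv_lhs => rw [hv, map_sum]
  refine Finset.sum_congr rfl fun a _ => ?_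
  rw [map_smul, smul_eq_mul, mul_comm]

theorem deriv (hf : Density E d f) : Density E (d + 1) (fun u x => deriv (f u) x) := by
  induction hf with
  | coeff c hc =>
    have : Density E (0 + 1) (fun (u : Loop n) x =>
        ∑ a, fderiv ℝ c (u.1 x) (Pi.single a 1) * _root_.jet u (0 + 1) a x) :=
      sum _ fun a _ => ((coeff _ (contDiff_partial hc a)).mul (jet 0 a)).cast (zero_add _)
    refine this.congr fun u x => ?_
    refine (hasDerivAt_coeff hc (γ := u.1) (t := x) fun a => ?_).deriv.symm
    have := hasDerivAt_jet u 0 a x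
    rwa [show _root_.jet u 0 a = fun x => u.1 x a from funext fun x => jet_zero u a x] at this
  | jet s a => exact (jet (s + 1) a).congr fun u x => by rw [← deriv_jet]
  | explicit hE d κ hs hp =>
    exact explicit hE (d + 1) _ (contDiff_infty_iff_deriv.1 hs).2 (periodic_deriv hp)
  | zero d => exact (zero _).congr fun u x => by simp
  | add hf hg h1 h2 =>
    exact (h1.add h2).congr fun u x => ((hf.hasDerivAt u x).add (hg.hasDerivAt u x)).deriv.symm
  | mul hf hg h1 h2 =>
    refine ((h1.mul hg).cast (by ring) |>.add ((hf.mul h2).cast (by ring))).congr fun u x =>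
      ((hf.hasDerivAt u x).mul (hg.hasDerivAt u x)).deriv.symm

theorem iteratedDeriv (hf : Density E d f) (s : ℕ) :
    Density E (d + s) (fun u x => iteratedDeriv s (f u) x) := by
  induction s with
  | zero => simpa using hf
  | succ s ih => exact ih.deriv.congr fun u x => by rw [iteratedDeriv_succ]

theorem eq_zero_at_zero (hf : Density False d f) (hd : d ≠ 0) (x : ℝ) : f 0 x = 0 := by
  induction hf with
  | coeff c hc => exact absurd rfl hd
  | jet s a => simpa using jet_smul 0 (0 : Loop n) (s + 1) a x
  | explicit hE => exact hE.elim
  | zero d => rfl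
  | add _ _ h1 h2 => simp only [h1 hd, h2 hd, add_zero]
  | @mul d e _ _ _ _ h1 h2 =>
    rcases Nat.eq_zero_or_pos d with h | h
    · simp only [h2 (by omega), mul_zero]
    · simp only [h1 (by omega), zero_mul]

end Density

/-! ## Linear differential forms -/

/-- Linear differential expressions in a loop `φ` with densities as coefficients. -/
inductive LForm (E : Prop) : ℕ → (Loop n → Loop n → ℝ → ℝ) → Prop
  | single {d : ℕ} {f : Loop n → ℝ → ℝ} (hf : Density E d f) (s : ℕ) (a : Fin n) :
      LForm E (d + s) (fun u φ x => f u x * jet φ s a x)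
  | zero (d : ℕ) : LForm E d (fun _ _ _ => 0)
  | add {d : ℕ} {L M : Loop n → Loop n → ℝ → ℝ} (hL : LForm E d L) (hM : LForm E d M) :
      LForm E d (fun u φ x => L u φ x + M u φ x)

namespace LForm

variable {E : Prop} {d e : ℕ} {L M : Loop n → Loop n → ℝ → ℝ} {f : Loop n → ℝ → ℝ}

theorem cast (hL : LForm E d L) (h : d = e) : LForm E e L := h ▸ hL

theorem congr (hL : LForm E d L) (h : ∀ u φ x, L u φ x = M u φ x) : LForm E d M := by
  have : L = M := funext fun u => funext fun φ => funext fun x => h u φ x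
  exact this ▸ hL

theorem mul_left (hf : Density E e f) (hL : LForm E d L) :
    LForm E (d + e) (fun u φ x => f u x * L u φ x) := by
  induction hL with
  | @single d g hg s a =>
    exact ((single (hf.mul hg) s a).cast (by ring)).congr fun u φ x => by ring
  | zero d => exact (zero _).congr fun u φ x => by simp
  | add _ _ h1 h2 => exact (h1.add h2).congr fun u φ x => by ring

theorem const_mul (c : ℝ) (hL : LForm E d L) : LForm E d (fun u φ x => c * L u φ x) :=
  hL.mul_left (Density.const c)

theorem neg (hL : LForm E d L) : LForm E d (fun u φ x => -L u φ x) :=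
  (hL.const_mul (-1)).congr fun u φ x => by ring

theorem sub (hL : LForm E d L) (hM : LForm E d M) :
    LForm E d (fun u φ x => L u φ x - M u φ x) :=
  (hL.add hM.neg).congr fun u φ x => by ring

theorem sum {ι : Type*} (s : Finset ι) {L : ι → Loop n → Loop n → ℝ → ℝ}
    (hL : ∀ i ∈ s, LForm E d (L i)) : LForm E d (fun u φ x => ∑ i ∈ s, L i u φ x) := by
  classical
  induction s using Finset.induction_on with
  | empty => simpa using LForm.zero d
  | insert i s hi ih =>
    refine ((hL i (by simp)).add (ih fun j hj => hL j (by simp [hj]))).congr fun u φ x => ?_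
    rw [Finset.sum_insert hi]

theorem mono {E' : Prop} (h : E → E') (hL : LForm E d L) : LForm E' d L := by
  induction hL with
  | single hf s a => exact single (hf.mono h) s a
  | zero d => exact zero d
  | add _ _ h1 h2 => exact h1.add h2

theorem jet (s : ℕ) (a : Fin n) : LForm E s (fun (_ : Loop n) φ x => _root_.jet φ s a x) :=
  ((single (Density.const 1) s a).cast (zero_add s)).congr fun _ _ _ => one_mul _

theorem map_add (hL : LForm E d L) (u φ ψ : Loop n) (x : ℝ) :
    L u (φ + ψ) x = L u φ x + L u ψ x := by
  induction hL with
  | single hf s a => simp only [jet_add]; ring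
  | zero d => simp
  | add _ _ h1 h2 => simp only [h1, h2]; ring

theorem map_smul (hL : LForm E d L) (c : ℝ) (u φ : Loop n) (x : ℝ) :
    L u (c • φ) x = c * L u φ x := by
  induction hL with
  | single hf s a => simp only [jet_smul]; ring
  | zero d => simp
  | add _ _ h1 h2 => simp only [h1, h2]; ring

theorem contDiff (hL : LForm E d L) (u φ : Loop n) : ContDiff ℝ ∞ (L u φ) := by
  induction hL with
  | single hf s a => exact (hf.contDiff u).mul (contDiff_jet φ s a)
  | zero d => exact contDiff_const
  | add _ _ h1 h2 => exact h1.add h2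

theorem periodic (hL : LForm E d L) (u φ : Loop n) : Function.Periodic (L u φ) 1 := by
  induction hL with
  | single hf s a => exact (hf.periodic u).mul (periodic_jet φ s a)
  | zero d => intro x; rfl
  | add _ _ h1 h2 => exact h1.add h2

theorem hasDerivAt (hL : LForm E d L) (u φ : Loop n) (x : ℝ) :
    HasDerivAt (L u φ) (deriv (L u φ) x) x :=
  ((hL.contDiff u φ).differentiable (by simp) x).hasDerivAt

theorem deriv (hL : LForm E d L) : LForm E (d + 1) (fun u φ x => deriv (L u φ) x) := by
  induction hL with
  | @single d f hf s a =>
    refine (((single hf.deriv s a).cast (by ring)).add (single hf (s + 1) a)).congr fun u φ x => ?_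
    exact ((hf.hasDerivAt u x).mul (hasDerivAt_jet φ s a x)).deriv.symm
  | zero d => exact (zero _).congr fun u φ x => by simp
  | add hL hM h1 h2 =>
    exact (h1.add h2).congr fun u φ x =>
      ((hL.hasDerivAt u φ x).add (hM.hasDerivAt u φ x)).deriv.symm

theorem iteratedDeriv (hL : LForm E d L) (s : ℕ) :
    LForm E (d + s) (fun u φ x => iteratedDeriv s (L u φ) x) := by
  induction s with
  | zero => simpa using hL
  | succ s ih => exact ih.deriv.congr fun u φ x => by rw [iteratedDeriv_succ]

/-- Evaluation on a fixed loop. -/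
theorem density (hL : LForm E d L) (φ : Loop n) : Density True d (fun u x => L u φ x) := by
  induction hL with
  | single hf s a =>
    exact (hf.mono fun _ => trivial).mul
      (.explicit trivial s _ (contDiff_jet φ s a) (periodic_jet φ s a))
  | zero d => exact .zero d
  | add _ _ h1 h2 => exact h1.add h2

/-- Evaluation on a constant loop. -/
theorem density_const (hL : LForm E d L) (c : Fin n → ℝ) :
    Density E d (fun u x => L u (constLoop c) x) := by
  induction hL with
  | @single d f hf s a =>
    cases s with
    | zero => exact (hf.const_mul (c a)).congr fun u x => by simp only [jet_constLoop_zero, mul_comm]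
    | succ s => exact (Density.zero _).congr fun u x => by simp only [jet_constLoop_succ, mul_zero]
  | zero d => exact .zero d
  | add _ _ h1 h2 => exact h1.add h2

/-- Evaluation on a field. -/
theorem density_comp (hL : LForm E d L) {X : Loop n → Loop n}
    (hX : ∀ a, Density E e (fun u x => (X u).1 x a)) :
    Density E (d + e) (fun u x => L u (X u) x) := by
  induction hL with
  | single hf s a =>
    exact (hf.mul ((hX a).iteratedDeriv s)).cast (by ring)
  | zero d => exact .zero _
  | add _ _ h1 h2 => exact h1.add h2

theorem comp (hL : LForm E d L) {P : Loop n → Loop n → Loop n}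
    (hP : ∀ a, LForm E e (fun u φ x => (P u φ).1 x a)) :
    LForm E (d + e) (fun u φ x => L u (P u φ) x) := by
  induction hL with
  | single hf s a =>
    exact (((hP a).iteratedDeriv s).mul_left hf).cast (by ring)
  | zero d => exact .zero _
  | add _ _ h1 h2 => exact h1.add h2

/-- Locality: the value at `x` depends only on the germ of the argument at `x`. -/
theorem congr_of_eventuallyEq (hL : LForm E d L) (u : Loop n) {φ ψ : Loop n} {x : ℝ}
    (h : ∀ᶠ y in nhds x, φ.1 y = ψ.1 y) : L u φ x = L u ψ x := by
  induction hL with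
  | single hf s a =>
    have : (fun y => φ.1 y a) =ᶠ[nhds x] fun y => ψ.1 y a := h.mono fun y hy => by simp only [hy]
    simp only [_root_.jet, this.iteratedDeriv_eq s]
  | zero d => rfl
  | add _ _ h1 h2 => simp only [h1, h2]

end LForm

/-- The derivative of a density is a linear differential form of the same degree. -/
theorem Density.exists_hasDerivAt {E : Prop} {d : ℕ} {f : Loop n → ℝ → ℝ} (hf : Density E d f) :
    ∃ L, LForm E d L ∧ ∀ u φ x, HasDerivAt (fun s : ℝ => f (u + s • φ) x) (L u φ x) 0 := by
  have hjet : ∀ (s : ℕ) (a : Fin n) (u φ : Loop n) (x : ℝ),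
      HasDerivAt (fun t : ℝ => _root_.jet (u + t • φ) s a x) (_root_.jet φ s a x) 0 := by
    intro s a u φ x
    simp only [jet_add, jet_smul]
    simpa using ((hasDerivAt_id (0 : ℝ)).mul_const (_root_.jet φ s a x)).const_add
      (_root_.jet u s a x)
  induction hf with
  | coeff c hc =>
    refine ⟨fun u φ x => ∑ a, fderiv ℝ c (u.1 x) (Pi.single a 1) * _root_.jet φ 0 a x,
      LForm.sum _ fun a _ => LForm.single (Density.coeff _ (contDiff_partial hc a)) 0 a,
      fun u φ x => ?_⟩
    have := hasDerivAt_coeff hc (γ := fun t => (u + t • φ).1 x) (v := fun a => _root_.jet φ 0 a x)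
      (t := 0) fun a => by simpa only [jet_zero] using hjet 0 a u φ x
    simpa using this
  | jet s a => exact ⟨_, LForm.jet (s + 1) a, hjet (s + 1) a⟩
  | explicit hE d κ hs hp => exact ⟨_, LForm.zero d, fun u φ x => hasDerivAt_const _ _⟩
  | zero d => exact ⟨_, LForm.zero d, fun u φ x => hasDerivAt_const _ _⟩
  | add _ _ h1 h2 =>
    obtain ⟨L, hL, h1⟩ := h1
    obtain ⟨M, hM, h2⟩ := h2
    exact ⟨_, hL.add hM, fun u φ x => (h1 u φ x).add (h2 u φ x)⟩
  | @mul d e f g hf hg h1 h2 =>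
    obtain ⟨L, hL, h1⟩ := h1
    obtain ⟨M, hM, h2⟩ := h2
    refine ⟨_, (hL.mul_left hg).add ((hM.mul_left hf).cast (add_comm _ _)), fun u φ x => ?_⟩
    refine ((h1 u φ x).mul (h2 u φ x)).congr_deriv ?_
    simp only [zero_smul, add_zero]
    ring

end

section

variable {n : ℕ}

/-! ## Densities without explicit dependence on the point are differential polynomials -/

namespace Density

variable {E : Prop} {d e : ℕ} {f g : Loop n → ℝ → ℝ}

theorem pow (hf : Density E d f) (k : ℕ) : Density E (k * d) (fun u x => f u x ^ k) := by
  induction k with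
  | zero => exact ((const 1).cast (by simp)).congr fun u x => (pow_zero _).symm
  | succ k ih => exact ((ih.mul hf).cast (by ring)).congr fun u x => (pow_succ _ _).symm

theorem prod {ι : Type*} (s : Finset ι) {d : ι → ℕ} {f : ι → Loop n → ℝ → ℝ}
    (hf : ∀ i ∈ s, Density E (d i) (f i)) :
    Density E (∑ i ∈ s, d i) (fun u x => ∏ i ∈ s, f i u x) := by
  classical
  induction s using Finset.induction_on with
  | empty => simpa using const 1
  | insert i s hi ih =>
    rw [Finset.sum_insert hi]
    refine ((hf i (by simp)).mul (ih fun j hj => hf j (by simp [hj]))).congr fun u x => ?_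
    rw [Finset.prod_insert hi]

end Density

theorem DiffPoly.evalAt_eq (p : DiffPoly n) (u : Loop n) (x : ℝ) :
    p.evalAt u x = ∑ m ∈ p.support, (p.coeff m).1 (u.1 x) *
      ∏ i ∈ m.support, jet u (i.2 + 1) i.1 x ^ m i := by
  rw [DiffPoly.evalAt, MvPolynomial.eval₂_eq]
  rfl

theorem DiffPoly.IsHomogeneousOfDegree.density_monomial {p : DiffPoly n} {d : ℕ}
    (hp : p.IsHomogeneousOfDegree d) {m : Fin n × ℕ →₀ ℕ} (hm : m ∈ p.support) (E : Prop) :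
    Density E d (fun (u : Loop n) x => ∏ i ∈ m.support, jet u (i.2 + 1) i.1 x ^ m i) := by
  have h := hp (MvPolynomial.mem_support_iff.1 hm)
  refine (Density.prod m.support fun i _ => (Density.jet i.2 i.1).pow (m i)).cast ?_
  rw [← h, Finsupp.weight_apply, Finsupp.sum]
  rfl

theorem DiffPoly.IsHomogeneousOfDegree.density {p : DiffPoly n} {d : ℕ}
    (hp : p.IsHomogeneousOfDegree d) (E : Prop) : Density E d p.evalAt := by
  refine (Density.sum p.support fun m hm => ((Density.coeff _ (p.coeff m).2).mul
    (hp.density_monomial hm E)).cast (zero_add d)).congr fun u x => (p.evalAt_eq u x).symm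

theorem Density.exists_diffPoly {d : ℕ} {f : Loop n → ℝ → ℝ} (hf : Density False d f) :
    ∃ p : DiffPoly n, p.IsHomogeneousOfDegree d ∧ ∀ u x, f u x = p.evalAt u x := by
  induction hf with
  | coeff c hc =>
    refine ⟨MvPolynomial.C ⟨c, hc⟩, MvPolynomial.isWeightedHomogeneous_C _ _, fun u x => ?_⟩
    rw [DiffPoly.evalAt, MvPolynomial.eval₂_C]
    rfl
  | jet s a =>
    refine ⟨MvPolynomial.X (a, s), MvPolynomial.isWeightedHomogeneous_X _ _ _, fun u x => ?_⟩
    rw [DiffPoly.evalAt, MvPolynomial.eval₂_X]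
    rfl
  | explicit hE => exact hE.elim
  | zero d =>
    refine ⟨0, MvPolynomial.isWeightedHomogeneous_zero _ _ _, fun u x => ?_⟩
    rw [DiffPoly.evalAt, MvPolynomial.eval₂_zero]
  | add _ _ h1 h2 =>
    obtain ⟨p, hp, h1⟩ := h1
    obtain ⟨q, hq, h2⟩ := h2
    refine ⟨p + q, hp.add hq, fun u x => ?_⟩
    simp only [DiffPoly.evalAt, MvPolynomial.eval₂_add, h1, h2]
  | mul _ _ h1 h2 =>
    obtain ⟨p, hp, h1⟩ := h1
    obtain ⟨q, hq, h2⟩ := h2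
    refine ⟨p * q, hp.mul hq, fun u x => ?_⟩
    simp only [DiffPoly.evalAt, MvPolynomial.eval₂_mul, h1, h2]

/-- Averaging along the ray through `u` preserves homogeneous differential polynomials. -/
theorem Density.ray_integral {d : ℕ} {f : Loop n → ℝ → ℝ} (hf : Density False d f) (j : ℕ) :
    Density False d (fun u x => ∫ t in (0 : ℝ)..1, t ^ j * f (t • u) x) := by
  obtain ⟨p, hp, hfp⟩ := hf.exists_diffPoly
  have hc : ∀ m : Fin n × ℕ →₀ ℕ, ContDiff ℝ ∞ (fun q : (Fin n → ℝ) × ℝ =>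
      q.2 ^ (j + ∑ i ∈ m.support, m i) * (p.coeff m).1 (q.2 • q.1)) := fun m =>
    (contDiff_snd.pow _).mul
      (ContDiff.comp (p.coeff m).2 (contDiff_snd.smul contDiff_fst))
  refine (Density.sum p.support fun m hm => ((Density.coeff _ (contDiff_integral_param (hc m))).mul
    (hp.density_monomial hm False)).cast (zero_add d)).congr fun u x => ?_
  have hint : ∀ m ∈ p.support, IntervalIntegrable (fun t : ℝ =>
      t ^ (j + ∑ i ∈ m.support, m i) * (p.coeff m).1 (t • u.1 x) *
      ∏ i ∈ m.support, _root_.jet u (i.2 + 1) i.1 x ^ m i) MeasureTheory.volume 0 1 := fun m _ =>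
    (((hc m).continuous.comp (by fun_prop : Continuous fun t : ℝ => (u.1 x, t))).mul
      continuous_const).intervalIntegrable _ _
  simp only [← intervalIntegral.integral_mul_const]
  rw [← intervalIntegral.integral_finsetSum hint]
  congr 1
  funext t
  rw [hfp, p.evalAt_eq, Finset.mul_sum]
  refine Finset.sum_congr rfl fun m _ => ?_
  simp only [jet_smul, mul_pow, Finset.prod_mul_distrib, Finset.prod_pow_eq_pow_sum, pow_add]
  change _ = t ^ j * ((p.coeff m).1 (t • u.1 x) * _)
  ring

end

section

variable {n : ℕ}

/-! ## The pairing -/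

theorem Loop.continuous_coord (u : Loop n) (a : Fin n) : Continuous (fun y => u.1 y a) :=
  (contDiff_coord u a).continuous

theorem pairing_intervalIntegrable (v α : Loop n) :
    IntervalIntegrable (fun x => ∑ a, v.1 x a * α.1 x a) MeasureTheory.volume 0 1 :=
  (continuous_finsetSum _ fun a _ =>
    (Loop.continuous_coord v a).mul (Loop.continuous_coord α a)).intervalIntegrable _ _

theorem pairing_comm (v α : Loop n) : loopPairing v α = loopPairing α v := by
  simp only [loopPairing, mul_comm]

theorem pairing_add_left (v w α : Loop n) :
    loopPairing (v + w) α = loopPairing v α + loopPairing w α := by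
  simp only [loopPairing, Loop.add_val, add_mul, Finset.sum_add_distrib]
  exact intervalIntegral.integral_add (pairing_intervalIntegrable v α)
    (pairing_intervalIntegrable w α)

theorem pairing_smul_left (c : ℝ) (v α : Loop n) :
    loopPairing (c • v) α = c * loopPairing v α := by
  simp only [loopPairing, Loop.smul_val, mul_assoc, ← Finset.mul_sum,
    intervalIntegral.integral_const_mul]

theorem pairing_add_right (v α β : Loop n) :
    loopPairing v (α + β) = loopPairing v α + loopPairing v β := by
  rw [pairing_comm, pairing_add_left, pairing_comm α, pairing_comm β]

theorem pairing_smul_right (c : ℝ) (v α : Loop n) :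
    loopPairing v (c • α) = c * loopPairing v α := by
  rw [pairing_comm, pairing_smul_left, pairing_comm]

theorem pairing_neg_left (v α : Loop n) : loopPairing (-v) α = -loopPairing v α := by
  rw [← neg_one_smul ℝ, pairing_smul_left]; ring

theorem pairing_neg_right (v α : Loop n) : loopPairing v (-α) = -loopPairing v α := by
  rw [pairing_comm, pairing_neg_left, pairing_comm]

theorem pairing_sub_left (v w α : Loop n) :
    loopPairing (v - w) α = loopPairing v α - loopPairing w α := by
  rw [sub_eq_add_neg, pairing_add_left, pairing_neg_left]; ring

theorem pairing_zero_left (α : Loop n) : loopPairing 0 α = 0 := by simp [loopPairing]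

theorem pairing_zero_right (α : Loop n) : loopPairing α 0 = 0 := by simp [loopPairing]

theorem pairing_sum_left {ι : Type*} (s : Finset ι) (v : ι → Loop n) (α : Loop n) :
    loopPairing (∑ i ∈ s, v i) α = ∑ i ∈ s, loopPairing (v i) α := by
  classical
  induction s using Finset.induction_on with
  | empty => simp [pairing_zero_left]
  | insert i s hi ih => rw [Finset.sum_insert hi, Finset.sum_insert hi, pairing_add_left, ih]

theorem pairing_self_eq_zero {v : Loop n} (h : loopPairing v v = 0) : v = 0 := by
  have hc : Continuous fun x => ∑ a, v.1 x a * v.1 x a := continuous_finsetSum _ fun a _ =>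
    (Loop.continuous_coord v a).mul (Loop.continuous_coord v a)
  have hnn : ∀ x, 0 ≤ ∑ a, v.1 x a * v.1 x a := fun x =>
    Finset.sum_nonneg fun a _ => mul_self_nonneg _
  have hz : ∀ x ∈ Set.Ico (0 : ℝ) 1, ∑ a, v.1 x a * v.1 x a = 0 := by
    intro x hx
    by_contra hne
    have hpos := lt_of_le_of_ne (hnn x) (Ne.symm hne)
    have := intervalIntegral.integral_pos (one_pos) hc.continuousOn (fun y _ => hnn y)
      ⟨x, ⟨hx.1, hx.2.le⟩, hpos⟩
    rw [loopPairing] at h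
    linarith
  refine Loop.ext' fun x a => ?_
  have hx : v.1 x = v.1 (Int.fract x) := by
    have := v.2.2.sub_int_mul_eq ⌊x⌋ (x := x)
    rw [mul_one] at this
    exact this.symm
  have := hz (Int.fract x) ⟨Int.fract_nonneg x, Int.fract_lt_one x⟩
  rw [← hx, Finset.sum_eq_zero_iff_of_nonneg fun a _ => mul_self_nonneg _] at this
  simpa using this a (Finset.mem_univ a)

theorem pairing_ext_left {v w : Loop n} (h : ∀ α, loopPairing v α = loopPairing w α) : v = w := by
  refine sub_eq_zero.1 (pairing_self_eq_zero ?_)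
  rw [pairing_sub_left, h, sub_self]

theorem pairing_ext_right {v w : Loop n} (h : ∀ α, loopPairing α v = loopPairing α w) : v = w :=
  pairing_ext_left fun α => by rw [pairing_comm, h, pairing_comm]

theorem integral_deriv_mul_periodic {f g : ℝ → ℝ} (hf : ContDiff ℝ ∞ f) (hg : ContDiff ℝ ∞ g)
    (hfp : Function.Periodic f 1) (hgp : Function.Periodic g 1) :
    ∫ x in (0 : ℝ)..1, deriv f x * g x = -∫ x in (0 : ℝ)..1, f x * deriv g x := by
  have hf' := (contDiff_infty_iff_deriv.1 hf).2
  have hg' := (contDiff_infty_iff_deriv.1 hg).2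
  rw [intervalIntegral.integral_mul_deriv_eq_deriv_mul
    (fun x _ => (hf.differentiable (by simp) x).hasDerivAt)
    (fun x _ => (hg.differentiable (by simp) x).hasDerivAt)
    (hf'.continuous.intervalIntegrable _ _) (hg'.continuous.intervalIntegrable _ _)]
  have h1 := hfp 0
  have h2 := hgp 0
  rw [zero_add] at h1 h2
  rw [h1, h2]
  ring

theorem integral_iteratedDeriv_mul_periodic {f g : ℝ → ℝ} (hf : ContDiff ℝ ∞ f)
    (hg : ContDiff ℝ ∞ g) (hfp : Function.Periodic f 1) (hgp : Function.Periodic g 1) (s : ℕ) :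
    ∫ x in (0 : ℝ)..1, iteratedDeriv s f x * g x =
      (-1) ^ s * ∫ x in (0 : ℝ)..1, f x * iteratedDeriv s g x := by
  induction s generalizing f with
  | zero => simp
  | succ s ih =>
    rw [iteratedDeriv_succ', ih (contDiff_infty_iff_deriv.1 hf).2 (periodic_deriv hfp),
      integral_deriv_mul_periodic hf (iteratedDeriv_contDiff hg s) hfp
        (periodic_iteratedDeriv hgp s), iteratedDeriv_succ]
    ring

/-! ## Local vector fields and local operators -/

/-- The components of the vector field are densities of degree `d`. -/
def IsLocalField (E : Prop) (d : ℕ) (X : Loop n → Loop n) : Prop :=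
  ∀ a, Density E d (fun u x => (X u).1 x a)

/-- The operator field is differential, of degree `d`. -/
def IsLocalOp (E : Prop) (d : ℕ) (P : Loop n → Loop n → Loop n) : Prop :=
  ∀ a, LForm E d (fun u φ x => (P u φ).1 x a)

variable {E : Prop} {d e : ℕ} {X Y : Loop n → Loop n} {P Q : Loop n → Loop n → Loop n}

theorem IsLocalOp.mono {E' : Prop} (h : E → E') (hP : IsLocalOp E d P) : IsLocalOp E' d P :=
  fun a => (hP a).mono h

theorem IsLocalField.add (hX : IsLocalField E d X) (hY : IsLocalField E d Y) :
    IsLocalField E d (fun u => X u + Y u) := fun a => (hX a).add (hY a)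

theorem IsLocalField.sub (hX : IsLocalField E d X) (hY : IsLocalField E d Y) :
    IsLocalField E d (fun u => X u - Y u) := fun a => (hX a).sub (hY a)

theorem IsLocalField.neg (hX : IsLocalField E d X) : IsLocalField E d (fun u => -X u) := fun a => (hX a).neg

theorem IsLocalField.id : IsLocalField E 0 (fun u : Loop n => u) := fun a =>
  (Density.jet' 0 a).congr fun u x => jet_zero u a x

theorem IsLocalField.const (φ : Loop n) (d : ℕ) : IsLocalField True d (fun _ : Loop n => φ) := fun a =>
  .explicit trivial d _ (contDiff_coord φ a) fun x => congrFun (φ.2.2 x) a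

theorem IsLocalOp.cast (hP : IsLocalOp E d P) (h : d = e) : IsLocalOp E e P := h ▸ hP

theorem IsLocalField.cast (hX : IsLocalField E d X) (h : d = e) : IsLocalField E e X := h ▸ hX

theorem IsLocalOp.add (hP : IsLocalOp E d P) (hQ : IsLocalOp E d Q) : IsLocalOp E d (fun u φ => P u φ + Q u φ) :=
  fun a => (hP a).add (hQ a)

theorem IsLocalOp.sub (hP : IsLocalOp E d P) (hQ : IsLocalOp E d Q) : IsLocalOp E d (fun u φ => P u φ - Q u φ) :=
  fun a => (hP a).sub (hQ a)

theorem IsLocalOp.neg (hP : IsLocalOp E d P) : IsLocalOp E d (fun u φ => -P u φ) := fun a => (hP a).neg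

theorem IsLocalOp.smul (c : ℝ) (hP : IsLocalOp E d P) : IsLocalOp E d (fun u φ => c • P u φ) :=
  fun a => (hP a).const_mul c

theorem IsLocalOp.comp (hP : IsLocalOp E d P) (hQ : IsLocalOp E e Q) : IsLocalOp E (d + e) (fun u φ => P u (Q u φ)) :=
  fun a => (hP a).comp hQ

theorem IsLocalOp.apply (hP : IsLocalOp E d P) (hX : IsLocalField E e X) : IsLocalField E (d + e) (fun u => P u (X u)) :=
  fun a => (hP a).density_comp hX

theorem IsLocalOp.apply_fixed (hP : IsLocalOp E d P) (φ : Loop n) : IsLocalField True d (fun u => P u φ) :=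
  fun a => (hP a).density φ

theorem IsLocalOp.apply_const (hP : IsLocalOp E d P) (c : Fin n → ℝ) :
    IsLocalField E d (fun u => P u (constLoop c)) :=
  fun a => (hP a).density_const c

theorem IsLocalOp.map_add (hP : IsLocalOp E d P) (u φ ψ : Loop n) : P u (φ + ψ) = P u φ + P u ψ :=
  Loop.ext' fun x a => (hP a).map_add u φ ψ x

theorem IsLocalOp.map_smul (hP : IsLocalOp E d P) (c : ℝ) (u φ : Loop n) : P u (c • φ) = c • P u φ :=
  Loop.ext' fun x a => (hP a).map_smul c u φ x

theorem IsLocalOp.map_zero (hP : IsLocalOp E d P) (u : Loop n) : P u 0 = 0 := by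
  simpa using hP.map_smul 0 u 0

theorem IsLocalOp.map_neg (hP : IsLocalOp E d P) (u φ : Loop n) : P u (-φ) = -P u φ := by
  refine eq_neg_of_add_eq_zero_right ?_
  rw [← hP.map_add, add_neg_cancel, hP.map_zero]

theorem IsLocalOp.map_sub (hP : IsLocalOp E d P) (u φ ψ : Loop n) : P u (φ - ψ) = P u φ - P u ψ := by
  rw [sub_eq_add_neg, hP.map_add, hP.map_neg, ← sub_eq_add_neg]

theorem exists_isLocalOp {L : Fin n → Loop n → Loop n → ℝ → ℝ} (hL : ∀ a, LForm E d (L a)) :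
    ∃ P : Loop n → Loop n → Loop n, IsLocalOp E d P ∧ ∀ u φ x a, (P u φ).1 x a = L a u φ x := by
  have h : ∀ u φ x a, (toLoop fun x a => L a u φ x).1 x a = L a u φ x := fun u φ x a =>
    toLoop_apply (fun a => (hL a).contDiff u φ) (fun a => (hL a).periodic u φ) x a
  exact ⟨fun u φ => toLoop fun x a => L a u φ x,
    fun a => (hL a).congr fun u φ x => (h u φ x a).symm, h⟩

theorem exists_isLocalField {f : Fin n → Loop n → ℝ → ℝ} (hf : ∀ a, Density E d (f a)) :
    ∃ X : Loop n → Loop n, IsLocalField E d X ∧ ∀ u x a, (X u).1 x a = f a u x := by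
  have h : ∀ u x a, (toLoop fun x a => f a u x).1 x a = f a u x := fun u x a =>
    toLoop_apply (fun a => (hf a).contDiff u) (fun a => (hf a).periodic u) x a
  exact ⟨fun u => toLoop fun x a => f a u x,
    fun a => (hf a).congr fun u x => (h u x a).symm, h⟩

/-! ### Adjoints -/

theorem LForm.exists_adjoint {L : Loop n → Loop n → ℝ → ℝ} (hL : LForm E d L) (a : Fin n) :
    ∃ Q : Loop n → Loop n → Loop n, IsLocalOp E d Q ∧
      ∀ u φ β, ∫ x in (0 : ℝ)..1, L u φ x * β.1 x a = loopPairing φ (Q u β) := by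
  induction hL with
  | @single d f hf s b =>
    have hM : LForm E (d + s) (fun u β x =>
        (-1) ^ s * _root_.iteratedDeriv s (fun x => f u x * _root_.jet β 0 a x) x) :=
      ((LForm.single hf 0 a).iteratedDeriv s).const_mul _
    obtain ⟨Q, hQ, hQv⟩ := exists_isLocalOp (L := fun c u β x => if c = b then
      (-1) ^ s * _root_.iteratedDeriv s (fun x => f u x * _root_.jet β 0 a x) x else 0) (E := E) (d := d + s)
      (fun c => by
        by_cases hc : c = b
        · simpa only [hc, if_true] using hM
        · simpa only [hc, if_false] using LForm.zero _)
    refine ⟨Q, hQ, fun u φ β => ?_⟩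
    have key := integral_iteratedDeriv_mul_periodic (contDiff_coord φ b)
      ((hf.contDiff u).mul (contDiff_jet β 0 a)) (fun x => congrFun (φ.2.2 x) b)
      ((hf.periodic u).mul (periodic_jet β 0 a)) s
    simp only [loopPairing, hQv, mul_ite, mul_zero, Finset.sum_ite_eq', Finset.mem_univ, if_true]
    rw [← intervalIntegral.integral_const_mul] at key
    calc _ = ∫ x in (0 : ℝ)..1, _root_.iteratedDeriv s (fun y => φ.1 y b) x *
          (f u * _root_.jet β 0 a) x := by
          congr 1; funext x; simp only [Pi.mul_apply, jet_zero]; simp only [_root_.jet]; ring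
      _ = _ := key
      _ = _ := by congr 1; funext x; rw [mul_left_comm]
  | zero d =>
    obtain ⟨Q, hQ, hQv⟩ := exists_isLocalOp (L := fun (_ : Fin n) _ _ _ => 0)
      fun _ => LForm.zero (E := E) (n := n) d
    exact ⟨Q, hQ, fun u φ β => by simp [loopPairing, hQv]⟩
  | @add d L M hL hM h1 h2 =>
    obtain ⟨Q, hQ, h1⟩ := h1
    obtain ⟨R, hR, h2⟩ := h2
    refine ⟨_, hQ.add hR, fun u φ β => ?_⟩
    rw [pairing_add_right, ← h1, ← h2, ← intervalIntegral.integral_add]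
    · simp only [add_mul]
    · exact ((hL.contDiff u φ).continuous.mul (Loop.continuous_coord β a)).intervalIntegrable _ _
    · exact ((hM.contDiff u φ).continuous.mul (Loop.continuous_coord β a)).intervalIntegrable _ _

theorem isLocalOp_zero (d : ℕ) : IsLocalOp E d (fun _ _ => (0 : Loop n)) := fun _ => LForm.zero d

theorem IsLocalOp.sum {ι : Type*} (s : Finset ι) {P : ι → Loop n → Loop n → Loop n}
    (hP : ∀ i ∈ s, IsLocalOp E d (P i)) : IsLocalOp E d (fun u φ => ∑ i ∈ s, P i u φ) := fun a => by
  simp only [Loop.sum_val]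
  exact LForm.sum s fun i hi => hP i hi a

theorem IsLocalOp.exists_adjoint (hP : IsLocalOp E d P) :
    ∃ Q : Loop n → Loop n → Loop n, IsLocalOp E d Q ∧
      ∀ u φ β, loopPairing (P u φ) β = loopPairing φ (Q u β) := by
  choose Q hQ h using fun a => (hP a).exists_adjoint a
  refine ⟨_, IsLocalOp.sum Finset.univ fun a _ => hQ a, fun u φ β => ?_⟩
  rw [pairing_comm φ, pairing_sum_left]
  simp only [pairing_comm _ φ, ← h]
  rw [loopPairing, intervalIntegral.integral_finsetSum]
  exact fun a _ => (((hP a).contDiff u φ).continuous.mul (Loop.continuous_coord β a)).intervalIntegrable _ _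

theorem loopAdjoint_eq {A : Loop n → Loop n} {β w : Loop n}
    (h : ∀ φ, loopPairing (A φ) β = loopPairing φ w) : loopAdjoint A β = w := by
  have hex : ∃ w : Loop n, ∀ φ : Loop n, loopPairing (A φ) β = loopPairing φ w := ⟨w, h⟩
  rw [loopAdjoint, dif_pos hex]
  exact pairing_ext_right fun φ => (hex.choose_spec φ).symm.trans (h φ)

theorem IsLocalOp.pairing_adjoint (hP : IsLocalOp E d P) (u φ β : Loop n) :
    loopPairing (P u φ) β = loopPairing φ (loopAdjoint (P u) β) := by
  obtain ⟨Q, _, h⟩ := hP.exists_adjoint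
  rw [loopAdjoint_eq fun φ => h u φ β, h]

theorem IsLocalOp.adjoint (hP : IsLocalOp E d P) : IsLocalOp E d (fun u β => loopAdjoint (P u) β) := by
  obtain ⟨Q, hQ, h⟩ := hP.exists_adjoint
  convert hQ using 3 with u β
  exact loopAdjoint_eq fun φ => h u φ β

/-! ### Derivatives -/

theorem loopDeriv_eq {F : Loop n → Loop n} {u φ w : Loop n}
    (h : ∀ x a, HasDerivAt (fun s : ℝ => (F (u + s • φ)).1 x a) (w.1 x a) 0) :
    loopDeriv F u φ = w := by
  have hex : ∃ w : Loop n, ∀ x : ℝ, HasDerivAt (fun s : ℝ => (F (u + s • φ)).1 x) (w.1 x) 0 :=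
    ⟨w, fun x => hasDerivAt_pi.2 (h x)⟩
  rw [loopDeriv, dif_pos hex]
  exact Loop.ext' fun x a => (hasDerivAt_pi.1 (hex.choose_spec x) a).unique (h x a)

theorem IsLocalField.exists_deriv (hX : IsLocalField E d X) :
    ∃ Q : Loop n → Loop n → Loop n, IsLocalOp E d Q ∧
      ∀ u φ x a, HasDerivAt (fun s : ℝ => (X (u + s • φ)).1 x a) ((Q u φ).1 x a) 0 := by
  choose L hL h using fun a => (hX a).exists_hasDerivAt
  obtain ⟨Q, hQ, hQv⟩ := exists_isLocalOp hL
  exact ⟨Q, hQ, fun u φ x a => by rw [hQv]; exact h a u φ x⟩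

theorem IsLocalField.hasDerivAt (hX : IsLocalField E d X) (u φ : Loop n) (x : ℝ) (a : Fin n) :
    HasDerivAt (fun s : ℝ => (X (u + s • φ)).1 x a) ((loopDeriv X u φ).1 x a) 0 := by
  obtain ⟨Q, _, h⟩ := hX.exists_deriv
  rw [loopDeriv_eq (h u φ)]
  exact h u φ x a

theorem IsLocalField.deriv (hX : IsLocalField E d X) : IsLocalOp E d (loopDeriv X) := by
  obtain ⟨Q, hQ, h⟩ := hX.exists_deriv
  convert hQ using 1
  funext u φ
  exact loopDeriv_eq (h u φ)

theorem IsLocalOp.opDeriv (hP : IsLocalOp E d P) (α : Loop n) :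
    IsLocalOp True d (fun u φ => operatorDeriv P u α φ) := (hP.apply_fixed α).deriv

theorem IsLocalField.hasDerivAt_line (hX : IsLocalField E d X) (u φ : Loop n) (x : ℝ) (a : Fin n) (t : ℝ) :
    HasDerivAt (fun s : ℝ => (X (u + s • φ)).1 x a) ((loopDeriv X (u + t • φ) φ).1 x a) t := by
  have h := hX.hasDerivAt (u + t • φ) φ x a
  rw [← sub_self t] at h
  have h2 := h.comp_sub_const t t
  have e : ∀ s : ℝ, u + t • φ + (s - t) • φ = u + s • φ := fun s => by
    rw [add_assoc, ← add_smul, add_sub_cancel]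
  simpa only [e] using h2

theorem IsLocalField.hasDerivAt_pairing (hX : IsLocalField E d X) (u φ γ : Loop n) :
    HasDerivAt (fun s : ℝ => loopPairing (X (u + s • φ)) γ) (loopPairing (loopDeriv X u φ) γ) 0 := by
  refine hasDerivAt_integral_param
    (f := fun p : ℝ × ℝ => ∑ a, (X (u + p.1 • φ)).1 p.2 a * γ.1 p.2 a) ?_ ?_
  · exact ContDiff.sum fun a _ => ((hX a).contDiff_line u φ).mul
      ((contDiff_coord γ a).comp contDiff_snd)
  · intro x
    exact HasDerivAt.fun_sum fun a _ => (hX.hasDerivAt u φ x a).mul_const (γ.1 x a)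

theorem IsLocalField.loopDeriv_add (hX : IsLocalField E d X) (hY : IsLocalField E e Y) (u φ : Loop n) :
    loopDeriv (fun u => X u + Y u) u φ = loopDeriv X u φ + loopDeriv Y u φ :=
  loopDeriv_eq fun x a => (hX.hasDerivAt u φ x a).add (hY.hasDerivAt u φ x a)

theorem IsLocalField.loopDeriv_sub (hX : IsLocalField E d X) (hY : IsLocalField E e Y) (u φ : Loop n) :
    loopDeriv (fun u => X u - Y u) u φ = loopDeriv X u φ - loopDeriv Y u φ :=
  loopDeriv_eq fun x a => (hX.hasDerivAt u φ x a).sub (hY.hasDerivAt u φ x a)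

theorem IsLocalField.loopDeriv_neg (hX : IsLocalField E d X) (u φ : Loop n) :
    loopDeriv (fun u => -X u) u φ = -loopDeriv X u φ :=
  loopDeriv_eq fun x a => (hX.hasDerivAt u φ x a).neg

theorem IsLocalField.loopDeriv_smul (c : ℝ) (hX : IsLocalField E d X) (u φ : Loop n) :
    loopDeriv (fun u => c • X u) u φ = c • loopDeriv X u φ :=
  loopDeriv_eq fun x a => (hX.hasDerivAt u φ x a).const_mul c

theorem loopDeriv_const (w u φ : Loop n) : loopDeriv (fun _ => w) u φ = 0 :=
  loopDeriv_eq fun _ _ => hasDerivAt_const _ _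

theorem loopDeriv_id (u φ : Loop n) : loopDeriv (fun u => u) u φ = φ :=
  loopDeriv_eq fun x a => by
    simpa using ((hasDerivAt_id (0 : ℝ)).mul_const (φ.1 x a)).const_add (u.1 x a)

/-- Differentiation along a path in the loop space commutes with the derivatives on the line. -/
theorem IsLocalField.hasDerivAt_jet (hX : IsLocalField E d X) (u φ : Loop n) (s : ℕ) (x : ℝ) (a : Fin n) :
    HasDerivAt (fun t : ℝ => jet (X (u + t • φ)) s a x) (jet (loopDeriv X u φ) s a x) 0 := by
  have hc := (hX a).contDiff_line u φ
  have h1 : DifferentiableAt ℝ (fun t : ℝ => jet (X (u + t • φ)) s a x) 0 :=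
    ((hc.iteratedDeriv_snd s).comp_mk_left x).differentiable (by simp) 0
  refine h1.hasDerivAt.congr_deriv ((deriv_iteratedDeriv_comm hc s 0 x).trans ?_)
  rw [jet]
  congr 1
  funext y
  exact (hX.hasDerivAt u φ y a).deriv

theorem LForm.hasDerivAt_comp {L : Loop n → Loop n → ℝ → ℝ} (hL : LForm E d L)
    {E' : Prop} (hX : IsLocalField E' e X) (u φ : Loop n) (x : ℝ) :
    ∃ c, HasDerivAt (fun s : ℝ => L (u + s • φ) (X u) x) c 0 ∧
      HasDerivAt (fun s : ℝ => L (u + s • φ) (X (u + s • φ)) x) (c + L u (loopDeriv X u φ) x) 0 := by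
  induction hL with
  | @single d f hf s a =>
    obtain ⟨M, -, hM⟩ := hf.exists_hasDerivAt
    refine ⟨_, (hM u φ x).mul_const _, ((hM u φ x).mul (hX.hasDerivAt_jet u φ s x a)).congr_deriv ?_⟩
    simp
  | zero d => exact ⟨0, hasDerivAt_const _ _, by simpa using hasDerivAt_const _ _⟩
  | add _ _ h1 h2 =>
    obtain ⟨c, h1, h1'⟩ := h1
    obtain ⟨c', h2, h2'⟩ := h2
    exact ⟨c + c', h1.add h2, (h1'.add h2').congr_deriv (by ring)⟩

/-- The chain rule. -/
theorem IsLocalOp.loopDeriv_apply {E' : Prop} (hP : IsLocalOp E d P) (hX : IsLocalField E' e X) (u φ : Loop n) :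
    loopDeriv (fun u => P u (X u)) u φ =
      operatorDeriv P u (X u) φ + P u (loopDeriv X u φ) := by
  refine loopDeriv_eq fun x a => ?_
  obtain ⟨c, h1, h2⟩ := (hP a).hasDerivAt_comp hX u φ x
  refine h2.congr_deriv ?_
  rw [Loop.add_val, h1.unique ((hP.apply_fixed (X u)).hasDerivAt u φ x a)]
  rfl

theorem IsLocalField.loopDeriv_loopDeriv_comm (hX : IsLocalField E d X) (u φ ψ : Loop n) :
    loopDeriv (fun v => loopDeriv X v ψ) u φ = loopDeriv (fun v => loopDeriv X v φ) u ψ := by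
  refine loopDeriv_eq fun x a => ?_
  have hc := (hX a).contDiff_plane u φ ψ x
  have h := (hX.deriv.apply_fixed ψ).hasDerivAt u φ x a
  have h' := (hX.deriv.apply_fixed φ).hasDerivAt u ψ x a
  refine h.congr_deriv ?_
  rw [← h.deriv, ← h'.deriv]
  refine Eq.trans ?_ ((deriv_deriv_comm hc 0 0).trans ?_)
  · congr 1
    funext s
    simpa using (hX.hasDerivAt (u + s • φ) ψ x a).deriv.symm
  · congr 1
    funext s
    have := (hX.hasDerivAt (u + s • ψ) φ x a).deriv
    rw [← this]
    congr 1
    funext t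
    rw [add_right_comm]

theorem LForm.exists_deriv_along {L : Loop n → Loop n → ℝ → ℝ} (hL : LForm E d L)
    (hX : IsLocalField E e X) : ∃ M, LForm E (d + e) M ∧
      ∀ u α x, HasDerivAt (fun s : ℝ => L (u + s • X u) α x) (M u α x) 0 := by
  induction hL with
  | @single d f hf s a =>
    obtain ⟨M, hM, h⟩ := hf.exists_hasDerivAt
    exact ⟨_, (LForm.single (hM.density_comp hX) s a).cast (by ring),
      fun u α x => (h u (X u) x).mul_const _⟩
  | zero d => exact ⟨_, LForm.zero _, fun _ _ _ => hasDerivAt_const _ _⟩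
  | add _ _ h1 h2 =>
    obtain ⟨M, hM, h1⟩ := h1
    obtain ⟨M', hM', h2⟩ := h2
    exact ⟨_, hM.add hM', fun u α x => (h1 u α x).add (h2 u α x)⟩

theorem IsLocalOp.operatorDeriv_along (hP : IsLocalOp E d P) (hX : IsLocalField E e X) :
    IsLocalOp E (d + e) (fun u α => operatorDeriv P u α (X u)) := by
  choose M hM h using fun a => (hP a).exists_deriv_along hX
  obtain ⟨Q, hQ, hQv⟩ := exists_isLocalOp hM
  convert hQ using 3 with u α
  refine loopDeriv_eq fun x a => ?_
  rw [hQv]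
  exact h a u α x

end

section

variable {n : ℕ} {E : Prop} {d e k : ℕ} {X Y : Loop n → Loop n} {P Q R : Loop n → Loop n → Loop n}

/-! ## The Schouten bracket as a trilinear form, and the Lie derivative -/

theorem IsLocalOp.operatorDeriv_add (hP : IsLocalOp E d P) (hQ : IsLocalOp E e Q) (u α φ : Loop n) :
    operatorDeriv (fun u α => P u α + Q u α) u α φ = operatorDeriv P u α φ + operatorDeriv Q u α φ :=
  (hP.apply_fixed α).loopDeriv_add (hQ.apply_fixed α) u φ

theorem IsLocalOp.operatorDeriv_smul (c : ℝ) (hP : IsLocalOp E d P) (u α φ : Loop n) :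
    operatorDeriv (fun u α => c • P u α) u α φ = c • operatorDeriv P u α φ :=
  (hP.apply_fixed α).loopDeriv_smul c u φ

theorem IsLocalOp.hasDerivAt_pairing (hP : IsLocalOp E d P) (u φ α γ : Loop n) :
    HasDerivAt (fun s : ℝ => loopPairing (P (u + s • φ) α) γ)
      (loopPairing (operatorDeriv P u α φ) γ) 0 :=
  (hP.apply_fixed α).hasDerivAt_pairing u φ γ

theorem IsLocalOp.skew_operatorDeriv (hP : IsLocalOp E d P) (hs : IsSkew P) (u φ α γ : Loop n) :
    loopPairing (operatorDeriv P u α φ) γ = -loopPairing (operatorDeriv P u γ φ) α := by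
  refine (hP.hasDerivAt_pairing u φ α γ).unique ?_
  simp only [hs _ α γ, pairing_comm α]
  exact (hP.hasDerivAt_pairing u φ γ α).neg

/-- One term of the Schouten bracket. -/
noncomputable def triTerm (P Q : LoopOperator n) (u α β γ : Loop n) : ℝ :=
  loopPairing (operatorDeriv P u α (Q u β)) γ

/-- The cyclic sum of `⟨P'(α; Q β), γ⟩`. -/
noncomputable def triCyclic (P Q : LoopOperator n) (u α β γ : Loop n) : ℝ :=
  triTerm P Q u α β γ + triTerm P Q u β γ α + triTerm P Q u γ α β

/-- The trilinear form `⟨2 [P, Q](α, β), γ⟩`. -/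
noncomputable def triBracket (P Q : LoopOperator n) (u α β γ : Loop n) : ℝ :=
  triCyclic P Q u α β γ + triCyclic Q P u α β γ

theorem triBracket_comm (P Q : LoopOperator n) (u α β γ : Loop n) :
    triBracket P Q u α β γ = triBracket Q P u α β γ := add_comm _ _

theorem two_mul_pairing_schoutenBracket (hP : IsLocalOp E d P) (hQ : IsLocalOp E e Q)
    (hPs : IsSkew P) (hQs : IsSkew Q) (u α β γ : Loop n) :
    2 * loopPairing (schoutenBracket P Q u α β) γ = triBracket P Q u α β γ := by
  have h : ∀ {E e} {P Q : Loop n → Loop n → Loop n}, IsLocalOp E e P → IsSkew P → IsSkew Q →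
      loopPairing (Q u (operatorDerivAdjoint P u α β)) γ = triTerm P Q u β γ α := by
    intro E e P Q hP hPs hQs
    rw [hQs, operatorDerivAdjoint, pairing_comm, ← (hP.opDeriv α).pairing_adjoint,
      hP.skew_operatorDeriv hPs, neg_neg, triTerm]
  have h' : ∀ {E e} {P Q : Loop n → Loop n → Loop n}, IsLocalOp E e P → IsSkew P →
      triTerm P Q u γ α β = -loopPairing (operatorDeriv P u β (Q u α)) γ := by
    intro E e P Q hP hPs
    rw [triTerm, hP.skew_operatorDeriv hPs]
  rw [schoutenBracket, pairing_smul_left, pairing_add_left, pairing_sub_left, pairing_add_left,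
    pairing_add_left, pairing_sub_left, h hP hPs hQs, h hQ hQs hPs, triBracket, triCyclic,
    triCyclic, h' hP hPs, h' hQ hQs, triTerm, triTerm, triTerm, triTerm]
  ring

theorem triBracket_add_left (hP : IsLocalOp E d P) (hQ : IsLocalOp E d Q) (hR : IsLocalOp E e R)
    (u α β γ : Loop n) :
    triBracket (P + Q) R u α β γ = triBracket P R u α β γ + triBracket Q R u α β γ := by
  have h1 : ∀ α φ, operatorDeriv (P + Q) u α φ = operatorDeriv P u α φ + operatorDeriv Q u α φ :=
    hP.operatorDeriv_add hQ u
  have h2 : ∀ α β, operatorDeriv R u α ((P + Q) u β) =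
      operatorDeriv R u α (P u β) + operatorDeriv R u α (Q u β) := fun α β =>
    (hR.opDeriv α).map_add u _ _
  simp only [triBracket, triCyclic, triTerm, h1, h2, pairing_add_left]
  ring

theorem triBracket_smul_left (c : ℝ) (hP : IsLocalOp E d P) (hR : IsLocalOp E e R)
    (u α β γ : Loop n) :
    triBracket (c • P) R u α β γ = c * triBracket P R u α β γ := by
  have h1 : ∀ α φ, operatorDeriv (c • P) u α φ = c • operatorDeriv P u α φ :=
    hP.operatorDeriv_smul c u
  have h2 : ∀ α β, operatorDeriv R u α ((c • P) u β) = c • operatorDeriv R u α (P u β) :=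
    fun α β => (hR.opDeriv α).map_smul c u _
  simp only [triBracket, triCyclic, triTerm, h1, h2, pairing_smul_left]
  ring

theorem isLocalOp_lieDerivative (hX : IsLocalField E k X) (hP : IsLocalOp E d P) :
    IsLocalOp E (d + k) (lieDerivative X P) :=
  ((hP.operatorDeriv_along hX).sub ((hX.deriv.comp hP).cast (add_comm _ _))).sub
    (hP.comp hX.deriv.adjoint)

theorem pairing_lieDerivative (hX : IsLocalField E k X) (hPs : IsSkew P)
    (u α γ : Loop n) :
    loopPairing (lieDerivative X P u α) γ = loopPairing (operatorDeriv P u α (X u)) γ -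
      loopPairing (P u α) (loopAdjoint (loopDeriv X u) γ) +
      loopPairing (P u γ) (loopAdjoint (loopDeriv X u) α) := by
  rw [lieDerivative, pairing_sub_left, pairing_sub_left, hX.deriv.pairing_adjoint,
    hPs u _ γ, pairing_comm _ (P u γ)]
  ring

theorem isSkew_lieDerivative (hX : IsLocalField E k X) (hP : IsLocalOp E d P) (hPs : IsSkew P) :
    IsSkew (lieDerivative X P) := fun u α γ => by
  rw [pairing_comm α, pairing_lieDerivative hX hPs, pairing_lieDerivative hX hPs,
    hP.skew_operatorDeriv hPs]
  ring

/-- The derivative of the Lie derivative. -/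
theorem pairing_operatorDeriv_lieDerivative (hX : IsLocalField E k X) (hP : IsLocalOp E d P)
    (hPs : IsSkew P) (u α ψ γ : Loop n) :
    loopPairing (operatorDeriv (lieDerivative X P) u α ψ) γ =
      loopPairing (operatorDeriv (fun v => operatorDeriv P v α) u (X u) ψ) γ +
      loopPairing (operatorDeriv P u α (loopDeriv X u ψ)) γ -
      loopPairing (operatorDeriv (loopDeriv X) u (P u α) ψ) γ -
      loopPairing (operatorDeriv P u α ψ) (loopAdjoint (loopDeriv X u) γ) -
      loopPairing (operatorDeriv P u (loopAdjoint (loopDeriv X u) α) ψ) γ +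
      loopPairing (operatorDeriv (loopDeriv X) u (P u γ) ψ) α := by
  have a1 : IsLocalField True (d + k) fun v => operatorDeriv P v α (X v) :=
    (hP.operatorDeriv_along hX).apply_fixed α
  have a2 : IsLocalField True (k + d) fun v => loopDeriv X v (P v α) :=
    (hX.deriv.comp hP).apply_fixed α
  have a3 : IsLocalField True (d + k) fun v => P v (loopAdjoint (loopDeriv X v) α) :=
    (hP.comp hX.deriv.adjoint).apply_fixed α
  have h1 : loopDeriv (fun v => operatorDeriv P v α (X v)) u ψ = _ :=
    (hP.opDeriv α).loopDeriv_apply hX u ψ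
  have h2 : loopDeriv (fun v => loopDeriv X v (P v α)) u ψ = _ :=
    hX.deriv.loopDeriv_apply (hP.apply_fixed α) u ψ
  have h3 : loopDeriv (fun v => P v (loopAdjoint (loopDeriv X v) α)) u ψ = _ :=
    hP.loopDeriv_apply (hX.deriv.adjoint.apply_fixed α) u ψ
  have h4 : ∀ η, loopPairing (loopDeriv (fun v => loopAdjoint (loopDeriv X v) α) u ψ) η =
      loopPairing (operatorDeriv (loopDeriv X) u η ψ) α := by
    intro η
    refine (hX.deriv.adjoint.hasDerivAt_pairing u ψ α η).unique ?_
    simp only [pairing_comm _ η, ← hX.deriv.pairing_adjoint]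
    exact hX.deriv.hasDerivAt_pairing u ψ η α
  have h5 : operatorDeriv (lieDerivative X P) u α ψ = _ :=
    ((a1.sub (a2.cast (add_comm _ _))).loopDeriv_sub a3 u ψ).trans
      (congrArg (· - _) (a1.loopDeriv_sub a2 u ψ))
  rw [h5, h1, h2, h3, pairing_sub_left, pairing_sub_left, pairing_add_left, pairing_add_left,
    pairing_add_left, hPs u _ γ, h4, hX.deriv.pairing_adjoint]
  change _ + _ - (_ + loopPairing (operatorDeriv P u α ψ) _) - _ = _
  ring

theorem hasDerivAt_triTerm (hX : IsLocalField E k X) (hP : IsLocalOp E d P) (hQ : IsLocalOp E e Q)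
    (hPs : IsSkew P) (u α β γ : Loop n) :
    HasDerivAt (fun s : ℝ => triTerm P Q (u + s • X u) α β γ)
      (triTerm (lieDerivative X P) Q u α β γ + triTerm P (lieDerivative X Q) u α β γ +
        triTerm P Q u (loopAdjoint (loopDeriv X u) α) β γ +
        triTerm P Q u α (loopAdjoint (loopDeriv X u) β) γ +
        triTerm P Q u α β (loopAdjoint (loopDeriv X u) γ) +
        loopPairing (operatorDeriv (loopDeriv X) u (P u α) (Q u β)) γ -
        loopPairing (operatorDeriv (loopDeriv X) u (P u γ) (Q u β)) α) 0 := by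
  have hPα := hP.opDeriv α
  have h := ((hPα.comp (hQ.mono fun _ => trivial)).apply_fixed β).hasDerivAt_pairing u (X u) γ
  refine h.congr_deriv ?_
  have h1 : loopDeriv (fun v => operatorDeriv P v α (Q v β)) u (X u) = _ :=
    hPα.loopDeriv_apply (hQ.apply_fixed β) u (X u)
  have h2 : operatorDeriv (fun v => operatorDeriv P v α) u (Q u β) (X u) =
      operatorDeriv (fun v => operatorDeriv P v α) u (X u) (Q u β) :=
    (hP.apply_fixed α).loopDeriv_loopDeriv_comm u (X u) (Q u β)
  rw [h1, pairing_add_left, h2, triTerm, pairing_operatorDeriv_lieDerivative hX hP hPs]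
  simp only [triTerm]
  have h3 : operatorDeriv P u α (lieDerivative X Q u β) =
      operatorDeriv P u α (operatorDeriv Q u β (X u)) -
      operatorDeriv P u α (loopDeriv X u (Q u β)) -
      operatorDeriv P u α (Q u (loopAdjoint (loopDeriv X u) β)) := by
    rw [lieDerivative, hPα.map_sub, hPα.map_sub]
  rw [h3, pairing_sub_left, pairing_sub_left]
  change _ + loopPairing (operatorDeriv P u α (operatorDeriv Q u β (X u))) γ = _
  ring

/-- The Lie derivative is a derivation of the Schouten bracket. -/
theorem hasDerivAt_triBracket (hX : IsLocalField E k X) (hP : IsLocalOp E d P)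
    (hQ : IsLocalOp E e Q) (hPs : IsSkew P) (hQs : IsSkew Q) (u α β γ : Loop n) :
    HasDerivAt (fun s : ℝ => triBracket P Q (u + s • X u) α β γ)
      (triBracket (lieDerivative X P) Q u α β γ + triBracket P (lieDerivative X Q) u α β γ +
        triBracket P Q u (loopAdjoint (loopDeriv X u) α) β γ +
        triBracket P Q u α (loopAdjoint (loopDeriv X u) β) γ +
        triBracket P Q u α β (loopAdjoint (loopDeriv X u) γ)) 0 := by
  have h := fun α β γ => hasDerivAt_triTerm hX hP hQ hPs u α β γ
  have h' := fun α β γ => hasDerivAt_triTerm hX hQ hP hQs u α β γ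
  have hs : ∀ φ ψ, operatorDeriv (loopDeriv X) u φ ψ = operatorDeriv (loopDeriv X) u ψ φ :=
    fun φ ψ => hX.loopDeriv_loopDeriv_comm u ψ φ
  refine ((((h α β γ).add (h β γ α)).add (h γ α β)).add
    (((h' α β γ).add (h' β γ α)).add (h' γ α β))).congr_deriv ?_
  simp only [triBracket, triCyclic]
  rw [hs (Q u α), hs (Q u β), hs (Q u γ), hs (Q u α), hs (Q u β), hs (Q u γ)]
  ring

/-! ### Linearity of the Lie derivative -/

theorem lieDerivative_add (hX : IsLocalField E k X) (hP : IsLocalOp E d P) (hQ : IsLocalOp E d Q) :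
    lieDerivative X (P + Q) = lieDerivative X P + lieDerivative X Q := by
  funext u α
  have h1 : operatorDeriv (P + Q) u α (X u) = _ := hP.operatorDeriv_add hQ u α (X u)
  simp only [lieDerivative, h1, Pi.add_apply, hX.deriv.map_add]
  abel

theorem lieDerivative_smul (c : ℝ) (hX : IsLocalField E k X) (hP : IsLocalOp E d P) :
    lieDerivative X (c • P) = c • lieDerivative X P := by
  funext u α
  have h1 : operatorDeriv (c • P) u α (X u) = _ := hP.operatorDeriv_smul c u α (X u)
  simp only [lieDerivative, h1, Pi.smul_apply, hX.deriv.map_smul]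
  module

theorem loopAdjoint_add (hX : IsLocalField E k X) (hY : IsLocalField E k Y) (u α : Loop n) :
    loopAdjoint (loopDeriv (fun u => X u + Y u) u) α =
      loopAdjoint (loopDeriv X u) α + loopAdjoint (loopDeriv Y u) α :=
  loopAdjoint_eq fun φ => by
    rw [hX.loopDeriv_add hY, pairing_add_left, pairing_add_right, hX.deriv.pairing_adjoint,
      hY.deriv.pairing_adjoint]

end

section

variable {n : ℕ} {m : ℕ} {X : Loop n → Loop n}

/-! ## Formal flows of vector fields -/

/-- Sequences of skewsymmetric operators whose `k`-th term is homogeneous of degree `k + 1`. -/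
def IsBivectorSeq (R : ℕ → LoopOperator n) : Prop :=
  ∀ k, IsLocalOp False (k + 1) (R k) ∧ IsSkew (R k)

/-- The coefficients of the bracket of two sequences of bivectors. -/
noncomputable def seqBracket (R R' : ℕ → LoopOperator n) (K : ℕ) (u α β γ : Loop n) : ℝ :=
  ∑ p ∈ Finset.HasAntidiagonal.antidiagonal K, triBracket (R p.1) (R' p.2) u α β γ

/-- The operator `ε ^ m L_X` on sequences. -/
noncomputable def lieShift (X : Loop n → Loop n) (m : ℕ) (R : ℕ → LoopOperator n) :
    ℕ → LoopOperator n :=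
  fun k => if m ≤ k then lieDerivative X (R (k - m)) else 0

/-- The terms of the exponential series of `ε ^ m L_X`. -/
noncomputable def lieTerm (X : Loop n → Loop n) (m : ℕ) (R : ℕ → LoopOperator n) (j : ℕ) :
    ℕ → LoopOperator n :=
  ((Nat.factorial j : ℝ))⁻¹ • (lieShift X m)^[j] R

/-- The exponential of `ε ^ m L_X`. -/
noncomputable def lieExp (X : Loop n → Loop n) (m : ℕ) (R : ℕ → LoopOperator n) :
    ℕ → LoopOperator n :=
  fun k => ∑ j ∈ Finset.range (k + 1), lieTerm X m R j k

theorem isSkew_zero : IsSkew (0 : LoopOperator n) := fun u α β => by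
  simp [pairing_zero_left, pairing_zero_right]

theorem IsSkew.add {P Q : LoopOperator n} (hP : IsSkew P) (hQ : IsSkew Q) : IsSkew (P + Q) :=
  fun u α β => by
    simp only [Pi.add_apply, pairing_add_left, pairing_add_right, hP u, hQ u]; ring

theorem IsSkew.smul {P : LoopOperator n} (c : ℝ) (hP : IsSkew P) : IsSkew (c • P) :=
  fun u α β => by
    simp only [Pi.smul_apply, pairing_smul_left, pairing_smul_right, hP u]; ring

theorem IsBivectorSeq.smul {R : ℕ → LoopOperator n} (c : ℝ) (hR : IsBivectorSeq R) :
    IsBivectorSeq (c • R) := fun k => ⟨(hR k).1.smul c, (hR k).2.smul c⟩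

theorem isLocalOp_sum {E : Prop} {d : ℕ} {ι : Type*} (s : Finset ι) {P : ι → LoopOperator n}
    (hP : ∀ i ∈ s, IsLocalOp E d (P i)) : IsLocalOp E d (∑ i ∈ s, P i) := by
  have : (∑ i ∈ s, P i) = fun u φ => ∑ i ∈ s, P i u φ := by
    funext u φ; simp only [Finset.sum_apply]
  exact this ▸ IsLocalOp.sum s hP

theorem isSkew_sum {ι : Type*} (s : Finset ι) {P : ι → LoopOperator n}
    (hP : ∀ i ∈ s, IsSkew (P i)) : IsSkew (∑ i ∈ s, P i) :=
  Finset.sum_induction _ IsSkew (fun _ _ => IsSkew.add) isSkew_zero hP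

theorem IsBivectorSeq.lieShift {R : ℕ → LoopOperator n} (hR : IsBivectorSeq R)
    (hX : IsLocalField False m X) : IsBivectorSeq (lieShift X m R) := fun k => by
  rw [_root_.lieShift]
  split_ifs with h
  · exact ⟨(isLocalOp_lieDerivative hX (hR (k - m)).1).cast (by omega),
      isSkew_lieDerivative hX (hR _).1 (hR _).2⟩
  · exact ⟨isLocalOp_zero _, isSkew_zero⟩

theorem IsBivectorSeq.iterate {R : ℕ → LoopOperator n} (hR : IsBivectorSeq R)
    (hX : IsLocalField False m X) (j : ℕ) : IsBivectorSeq ((_root_.lieShift X m)^[j] R) := by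
  induction j with
  | zero => exact hR
  | succ j ih => rw [Function.iterate_succ_apply']; exact ih.lieShift hX

theorem IsBivectorSeq.lieTerm {R : ℕ → LoopOperator n} (hR : IsBivectorSeq R)
    (hX : IsLocalField False m X) (j : ℕ) : IsBivectorSeq (lieTerm X m R j) :=
  (hR.iterate hX j).smul _

theorem IsBivectorSeq.lieExp {R : ℕ → LoopOperator n} (hR : IsBivectorSeq R)
    (hX : IsLocalField False m X) : IsBivectorSeq (lieExp X m R) := fun k =>
  ⟨isLocalOp_sum _ fun j _ => (hR.lieTerm hX j k).1, isSkew_sum _ fun j _ => (hR.lieTerm hX j k).2⟩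

theorem lieShift_lieTerm {R : ℕ → LoopOperator n} (hR : IsBivectorSeq R)
    (hX : IsLocalField False m X) (j : ℕ) :
    lieShift X m (lieTerm X m R j) = ((j : ℝ) + 1) • lieTerm X m R (j + 1) := by
  have h : lieShift X m (lieTerm X m R j) =
      ((Nat.factorial j : ℝ))⁻¹ • (lieShift X m)^[j + 1] R := by
    funext k
    rw [Function.iterate_succ_apply', Pi.smul_apply, lieShift, lieShift]
    split_ifs with h
    · exact lieDerivative_smul _ hX (hR.iterate hX j _).1
    · rw [smul_zero]
  rw [h, lieTerm, smul_smul, Nat.factorial_succ]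
  congr 1
  push_cast
  field_simp

theorem lieDerivative_zero {E : Prop} {k : ℕ} (hX : IsLocalField E k X) :
    lieDerivative X (0 : LoopOperator n) = 0 := by
  funext u α
  have h : operatorDeriv (0 : LoopOperator n) u α (X u) = 0 := loopDeriv_const 0 u (X u)
  simp [lieDerivative, h, hX.deriv.map_zero]

theorem iterate_lieShift_eq (hX : IsLocalField False m X) (R : ℕ → LoopOperator n) (j k : ℕ) :
    (lieShift X m)^[j] R k = if m * j ≤ k then (lieDerivative X)^[j] (R (k - m * j)) else 0 := by
  induction j generalizing k with
  | zero => simp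
  | succ j ih =>
    rw [Function.iterate_succ_apply', lieShift]
    by_cases h1 : m ≤ k
    · rw [if_pos h1, ih]
      by_cases h2 : m * j ≤ k - m
      · rw [if_pos h2, if_pos (by rw [mul_add]; omega), Function.iterate_succ_apply']
        congr 3
        rw [mul_add]; omega
      · rw [if_neg h2, if_neg (by rw [mul_add]; omega), lieDerivative_zero hX]
    · rw [if_neg h1, if_neg (by rw [mul_add]; omega)]

theorem lieTerm_eq_zero (hX : IsLocalField False m X) (hm : 1 ≤ m) (R : ℕ → LoopOperator n)
    {j k : ℕ} (h : k < j) : lieTerm X m R j k = 0 := by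
  rw [lieTerm, Pi.smul_apply, iterate_lieShift_eq hX, if_neg (by nlinarith), smul_zero]

theorem lieExp_eq_sum (hX : IsLocalField False m X) (hm : 1 ≤ m) (R : ℕ → LoopOperator n)
    {k N : ℕ} (h : k < N) : lieExp X m R k = ∑ j ∈ Finset.range N, lieTerm X m R j k := by
  refine Finset.sum_subset (fun j hj => ?_) fun j _ hj => lieTerm_eq_zero hX hm R ?_
  · simp only [Finset.mem_range] at hj ⊢; omega
  · simp only [Finset.mem_range] at hj; omega

theorem seqBracket_comm (R R' : ℕ → LoopOperator n) (K : ℕ) (u α β γ : Loop n) :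
    seqBracket R R' K u α β γ = seqBracket R' R K u α β γ := by
  rw [seqBracket, ← Finset.Nat.sum_antidiagonal_swap]
  simp only [seqBracket, Prod.fst_swap, Prod.snd_swap]
  exact Finset.sum_congr rfl fun p _ => triBracket_comm _ _ _ _ _ _

theorem seqBracket_smul_left (c : ℝ) {R R' : ℕ → LoopOperator n} (hR : IsBivectorSeq R)
    (hR' : IsBivectorSeq R') (K : ℕ) (u α β γ : Loop n) :
    seqBracket (c • R) R' K u α β γ = c * seqBracket R R' K u α β γ := by
  simp only [seqBracket, Finset.mul_sum, Pi.smul_apply]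
  exact Finset.sum_congr rfl fun p _ =>
    triBracket_smul_left c (hR p.1).1 (hR' p.2).1 u α β γ

theorem triBracket_zero_left {E : Prop} {d : ℕ} {Q : LoopOperator n} (hQ : IsLocalOp E d Q)
    (u α β γ : Loop n) : triBracket 0 Q u α β γ = 0 := by
  have h := triBracket_smul_left 0 hQ hQ u α β γ
  rwa [zero_smul, zero_mul] at h

theorem triBracket_sum_left {E : Prop} {d e : ℕ} {ι : Type*} (s : Finset ι)
    {P : ι → LoopOperator n} (hP : ∀ i ∈ s, IsLocalOp E d (P i)) {Q : LoopOperator n}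
    (hQ : IsLocalOp E e Q) (u α β γ : Loop n) :
    triBracket (∑ i ∈ s, P i) Q u α β γ = ∑ i ∈ s, triBracket (P i) Q u α β γ := by
  classical
  induction s using Finset.induction_on with
  | empty => simpa using triBracket_zero_left hQ u α β γ
  | insert i s hi ih =>
    rw [Finset.sum_insert hi, Finset.sum_insert hi, triBracket_add_left (hP i (by simp))
      (isLocalOp_sum s fun j hj => hP j (by simp [hj])) hQ,
      ih fun j hj => hP j (by simp [hj])]

theorem seqBracket_lieShift_left {R R' : ℕ → LoopOperator n}
    (hR' : IsBivectorSeq R') (K : ℕ) (u α β γ : Loop n) :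
    seqBracket (lieShift X m R) R' K u α β γ =
      if m ≤ K then seqBracket (fun k => lieDerivative X (R k)) R' (K - m) u α β γ else 0 := by
  have hz : ∀ p ∈ Finset.HasAntidiagonal.antidiagonal K, p.1 < m →
      triBracket (lieShift X m R p.1) (R' p.2) u α β γ = 0 := fun p _ hp => by
    rw [lieShift, if_neg (by omega)]
    exact triBracket_zero_left (hR' p.2).1 u α β γ
  split_ifs with h
  · symm
    rw [seqBracket, seqBracket]
    refine Finset.sum_of_injOn (fun p => (p.1 + m, p.2)) ?_ ?_ ?_ ?_
    · rintro ⟨a, b⟩ _ ⟨c, d⟩ _ h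
      simpa using h
    · rintro ⟨a, b⟩ hp
      simp only [Finset.mem_coe, Finset.HasAntidiagonal.mem_antidiagonal] at hp ⊢
      omega
    · rintro ⟨a, b⟩ hp hp'
      refine hz _ hp ?_
      by_contra hlt
      refine hp' ⟨(a - m, b), ?_, ?_⟩
      · simp only [Finset.mem_coe, Finset.HasAntidiagonal.mem_antidiagonal] at hp ⊢; simp at hlt; omega
      · simp at hlt ⊢; omega
    · rintro ⟨a, b⟩ _
      simp [lieShift]
  · refine Finset.sum_eq_zero fun p hp => hz p hp ?_
    rw [Finset.HasAntidiagonal.mem_antidiagonal] at hp; omega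

/-- `ε ^ m L_X` is a derivation of the bracket of sequences. -/
theorem sum_seqBracket_lieShift_eq_zero (hX : IsLocalField False m X) {ι : Type*} (s : Finset ι)
    {R R' : ι → ℕ → LoopOperator n} (hR : ∀ i, IsBivectorSeq (R i))
    (hR' : ∀ i, IsBivectorSeq (R' i))
    (h : ∀ K u α β γ, ∑ i ∈ s, seqBracket (R i) (R' i) K u α β γ = 0) (K : ℕ) (u α β γ : Loop n) :
    ∑ i ∈ s, (seqBracket (lieShift X m (R i)) (R' i) K u α β γ +
      seqBracket (R i) (lieShift X m (R' i)) K u α β γ) = 0 := by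
  simp only [seqBracket_comm (R _), seqBracket_lieShift_left (hR' _),
    seqBracket_lieShift_left (hR _)]
  split_ifs with hm
  swap
  · simp
  have hd : ∀ i, HasDerivAt (fun t : ℝ => seqBracket (R i) (R' i) (K - m) (u + t • X u) α β γ)
      (seqBracket (fun k => lieDerivative X (R i k)) (R' i) (K - m) u α β γ +
        seqBracket (fun k => lieDerivative X (R' i k)) (R i) (K - m) u α β γ +
        seqBracket (R i) (R' i) (K - m) u (loopAdjoint (loopDeriv X u) α) β γ +
        seqBracket (R i) (R' i) (K - m) u α (loopAdjoint (loopDeriv X u) β) γ +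
        seqBracket (R i) (R' i) (K - m) u α β (loopAdjoint (loopDeriv X u) γ)) 0 := fun i => by
    rw [seqBracket_comm _ (R i)]
    simp only [seqBracket, ← Finset.sum_add_distrib]
    exact HasDerivAt.fun_sum fun p _ => hasDerivAt_triBracket hX (hR i p.1).1 (hR' i p.2).1
      (hR i p.1).2 (hR' i p.2).2 u α β γ
  have h1 := HasDerivAt.fun_sum (u := s) fun i _ => hd i
  simp only [h] at h1
  have h2 := h1.unique (hasDerivAt_const _ _)
  simpa only [Finset.sum_add_distrib, h, add_zero] using h2

theorem succ_mul_sum_antidiagonal (J : ℕ) (g : ℕ × ℕ → ℝ) :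
    ((J : ℝ) + 1) * ∑ p ∈ Finset.HasAntidiagonal.antidiagonal (J + 1), g p =
      ∑ p ∈ Finset.HasAntidiagonal.antidiagonal J,
        (((p.1 : ℝ) + 1) * g (p.1 + 1, p.2) + ((p.2 : ℝ) + 1) * g (p.1, p.2 + 1)) := by
  have e1 := Finset.Nat.sum_antidiagonal_succ (n := J) (f := fun p : ℕ × ℕ => (p.1 : ℝ) * g p)
  have e2 := Finset.Nat.sum_antidiagonal_succ' (n := J) (f := fun p : ℕ × ℕ => (p.2 : ℝ) * g p)
  simp only [Nat.cast_zero, zero_mul, zero_add, Nat.cast_add, Nat.cast_one] at e1 e2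
  rw [Finset.sum_add_distrib, ← e1, ← e2, ← Finset.sum_add_distrib, Finset.mul_sum]
  refine Finset.sum_congr rfl fun p hp => ?_
  rw [← add_mul, ← Nat.cast_add, Finset.HasAntidiagonal.mem_antidiagonal.1 hp]
  push_cast
  ring

theorem sum_seqBracket_lieTerm_eq_zero (hX : IsLocalField False m X) {R : ℕ → LoopOperator n}
    (hR : IsBivectorSeq R) (h : ∀ K u α β γ, seqBracket R R K u α β γ = 0) (J : ℕ) :
    ∀ K u α β γ, ∑ p ∈ Finset.HasAntidiagonal.antidiagonal J,
      seqBracket (lieTerm X m R p.1) (lieTerm X m R p.2) K u α β γ = 0 := by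
  induction J with
  | zero => intro K u α β γ; simpa [lieTerm] using h K u α β γ
  | succ J ih =>
    intro K u α β γ
    have hA := hR.lieTerm hX
    have key := sum_seqBracket_lieShift_eq_zero hX (Finset.HasAntidiagonal.antidiagonal J)
      (R := fun p : ℕ × ℕ => lieTerm X m R p.1) (R' := fun p : ℕ × ℕ => lieTerm X m R p.2)
      (fun p => hA p.1) (fun p => hA p.2) ih K u α β γ
    simp only [lieShift_lieTerm hR hX] at key
    have hr : ∀ p : ℕ × ℕ, seqBracket (lieTerm X m R p.1)
        (((p.2 : ℝ) + 1) • lieTerm X m R (p.2 + 1)) K u α β γ =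
        ((p.2 : ℝ) + 1) * seqBracket (lieTerm X m R p.1) (lieTerm X m R (p.2 + 1)) K u α β γ :=
      fun p => by
        rw [seqBracket_comm, seqBracket_smul_left _ (hA _) (hA _), seqBracket_comm]
    simp only [hr, seqBracket_smul_left _ (hA _) (hA _), Finset.sum_add_distrib] at key
    rw [← Finset.sum_add_distrib, ← succ_mul_sum_antidiagonal J fun p =>
      seqBracket (lieTerm X m R p.1) (lieTerm X m R p.2) K u α β γ] at key
    exact (mul_eq_zero.1 key).resolve_left (by positivity)

/-- The formal flow of a vector field preserves the Jacobi identity. -/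
theorem seqBracket_lieExp (hX : IsLocalField False m X) (hm : 1 ≤ m) {R : ℕ → LoopOperator n}
    (hR : IsBivectorSeq R) (h : ∀ K u α β γ, seqBracket R R K u α β γ = 0) (K : ℕ)
    (u α β γ : Loop n) : seqBracket (lieExp X m R) (lieExp X m R) K u α β γ = 0 := by
  have hA := hR.lieTerm hX
  have hE := hR.lieExp hX
  set f : ℕ × ℕ → ℝ := fun q =>
    seqBracket (lieTerm X m R q.1) (lieTerm X m R q.2) K u α β γ with hf
  have hz : ∀ q : ℕ × ℕ, K < q.1 ∨ K < q.2 → f q = 0 := by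
    intro q hq
    refine Finset.sum_eq_zero fun p hp => ?_
    rw [Finset.HasAntidiagonal.mem_antidiagonal] at hp
    rcases hq with hq | hq
    · rw [lieTerm_eq_zero hX hm R (show p.1 < q.1 by omega)]
      exact triBracket_zero_left (hA _ _).1 u α β γ
    · rw [lieTerm_eq_zero hX hm R (show p.2 < q.2 by omega), triBracket_comm]
      exact triBracket_zero_left (hA _ _).1 u α β γ
  have h1 : seqBracket (lieExp X m R) (lieExp X m R) K u α β γ =
      ∑ q ∈ Finset.range (K + 1) ×ˢ Finset.range (K + 1), f q := by
    rw [Finset.sum_product]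
    simp only [hf, seqBracket]
    simp only [Finset.sum_comm (t := Finset.HasAntidiagonal.antidiagonal K)]
    refine Finset.sum_congr rfl fun p hp => ?_
    rw [Finset.HasAntidiagonal.mem_antidiagonal] at hp
    have e1 := lieExp_eq_sum hX hm R (show p.1 < K + 1 by omega)
    have e2 := lieExp_eq_sum hX hm R (show p.2 < K + 1 by omega)
    rw [e1, triBracket_sum_left _ (fun j _ => (hA j p.1).1) (hE p.2).1]
    refine Finset.sum_congr rfl fun i _ => ?_
    rw [e2, triBracket_comm, triBracket_sum_left _ (fun j _ => (hA j p.2).1) (hA i p.1).1]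
    exact Finset.sum_congr rfl fun j _ => triBracket_comm _ _ _ _ _ _
  rw [h1, ← Finset.sum_fiberwise_of_maps_to (t := Finset.range (2 * K + 1)) (g := fun q => q.1 + q.2)]
  · refine Finset.sum_eq_zero fun J _ => ?_
    rw [← sum_seqBracket_lieTerm_eq_zero hX hR h J K u α β γ]
    refine Finset.sum_subset (fun q hq => ?_) fun q hq hq' => hz q ?_
    · simp only [Finset.mem_filter] at hq
      exact Finset.HasAntidiagonal.mem_antidiagonal.2 hq.2
    · simp only [Finset.mem_filter, Finset.mem_product, Finset.mem_range,
        Finset.HasAntidiagonal.mem_antidiagonal] at hq hq'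
      omega
  · intro q hq
    simp only [Finset.mem_product, Finset.mem_range] at hq ⊢
    omega

end

section

variable {n : ℕ}

/-! ## Schur polynomials and the composition of formal flows -/

theorem IsLocalOp.iterate_lieDerivative {E : Prop} {d k : ℕ} {X : Loop n → Loop n}
    {P : LoopOperator n} (hX : IsLocalField E k X) (hP : IsLocalOp E d P) (i : ℕ) :
    IsLocalOp E (d + k * i) ((lieDerivative X)^[i] P) := by
  induction i with
  | zero => exact hP
  | succ i ih =>
    rw [Function.iterate_succ_apply']
    exact (isLocalOp_lieDerivative hX ih).cast (by ring)

theorem lieDerivative_sum {E : Prop} {d k : ℕ} {X : Loop n → Loop n} (hX : IsLocalField E k X)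
    {ι : Type*} (s : Finset ι) {P : ι → LoopOperator n} (hP : ∀ i ∈ s, IsLocalOp E d (P i)) :
    lieDerivative X (∑ i ∈ s, P i) = ∑ i ∈ s, lieDerivative X (P i) := by
  classical
  induction s using Finset.induction_on with
  | empty => simpa using lieDerivative_zero hX
  | insert i s hi ih =>
    rw [Finset.sum_insert hi, Finset.sum_insert hi, lieDerivative_add hX (hP i (by simp))
      (isLocalOp_sum s fun j hj => hP j (by simp [hj])), ih fun j hj => hP j (by simp [hj])]

theorem iterate_lieDerivative_sum {E : Prop} {d k : ℕ} {X : Loop n → Loop n}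
    (hX : IsLocalField E k X) {ι : Type*} (s : Finset ι) {P : ι → LoopOperator n}
    (hP : ∀ i ∈ s, IsLocalOp E d (P i)) (j : ℕ) :
    (lieDerivative X)^[j] (∑ i ∈ s, P i) = ∑ i ∈ s, (lieDerivative X)^[j] (P i) := by
  induction j with
  | zero => rfl
  | succ j ih =>
    simp only [Function.iterate_succ_apply']
    rw [ih, lieDerivative_sum hX s fun i hi => (hP i hi).iterate_lieDerivative hX j]

theorem isLocalOp_lieMonomial {X : ℕ → LoopVectorField n}
    (hX : ∀ k, 1 ≤ k → IsLocalField False k (X k)) {P : LoopOperator n} {d : ℕ}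
    (hP : IsLocalOp False d P) (m : ℕ) (j : Fin m → ℕ) :
    IsLocalOp False (d + ∑ i : Fin m, ((i : ℕ) + 1) * j i) (lieMonomial X m j P) := by
  induction m with
  | zero => simpa [lieMonomial] using hP
  | succ m ih =>
    rw [lieMonomial, Fin.sum_univ_castSucc, ← add_assoc]
    exact ((ih fun i => j i.castSucc).iterate_lieDerivative (hX (m + 1) (by omega)) _).smul _

/-- The composition of the first `m` formal flows, applied to the constant sequence of `P`. -/
noncomputable def lieFlow (X : ℕ → LoopVectorField n) (P : LoopOperator n) :
    ℕ → ℕ → LoopOperator n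
  | 0 => fun k => if k = 0 then P else 0
  | m + 1 => lieExp (X (m + 1)) (m + 1) (lieFlow X P m)

theorem lieFlow_eq {X : ℕ → LoopVectorField n} (hX : ∀ k, 1 ≤ k → IsLocalField False k (X k))
    {P : LoopOperator n} {d : ℕ} (hP : IsLocalOp False d P) {N : ℕ} (m k : ℕ) (hk : k < N) :
    lieFlow X P m k = ∑ j ∈ (Fintype.piFinset fun _ : Fin m => Finset.range N).filter
      (fun j => ∑ i : Fin m, ((i : ℕ) + 1) * j i = k), lieMonomial X m j P := by
  induction m generalizing k with
  | zero =>
    rw [Finset.sum_filter]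
    simp [lieFlow, lieMonomial, eq_comm]
  | succ m ih =>
    have hm := hX (m + 1) (by omega)
    have hmaps : ∀ j ∈ (Fintype.piFinset fun _ : Fin (m + 1) => Finset.range N).filter
        (fun j => ∑ i : Fin (m + 1), ((i : ℕ) + 1) * j i = k), j (Fin.last m) ∈ Finset.range N :=
      fun j hj => Fintype.mem_piFinset.1 (Finset.mem_filter.1 hj).1 _
    rw [lieFlow, lieExp_eq_sum hm (by omega) _ hk, ← Finset.sum_fiberwise_of_maps_to hmaps]
    refine Finset.sum_congr rfl fun i hi => ?_
    rw [lieTerm, Pi.smul_apply, iterate_lieShift_eq hm]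
    split_ifs with h
    · rw [ih _ (by omega), iterate_lieDerivative_sum (d := d + (k - (m + 1) * i)) hm, Finset.smul_sum]
      · refine Finset.sum_nbij' (fun j => Fin.snoc (α := fun _ => ℕ) j i)
          (fun j => Fin.init (α := fun _ => ℕ) j) ?_ ?_ ?_ ?_ ?_
        · intro j hj
          simp only [Finset.mem_filter, Fintype.mem_piFinset] at hj ⊢
          refine ⟨⟨fun a => ?_, ?_⟩, by simp⟩
          · refine Fin.lastCases ?_ (fun a => ?_) a
            · simpa using hi
            · simpa using hj.1 a
          · rw [Fin.sum_univ_castSucc]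
            simp [hj.2]
            omega
        · intro j hj
          simp only [Finset.mem_filter, Fintype.mem_piFinset] at hj ⊢
          obtain ⟨⟨h1, h2⟩, h3⟩ := hj
          rw [Fin.sum_univ_castSucc, h3] at h2
          simp only [Fin.val_castSucc, Fin.val_last] at h2
          refine ⟨fun a => h1 _, ?_⟩
          simp only [Fin.init]
          omega
        · intro j hj
          simp
        · intro j hj
          simp only [Finset.mem_filter] at hj
          rw [← hj.2, Fin.snoc_init_self]
        · intro j hj
          simp [lieMonomial]
      · intro j hj
        have := isLocalOp_lieMonomial hX hP m j
        rwa [(Finset.mem_filter.1 hj).2] at this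
    · rw [smul_zero]
      refine (Finset.sum_eq_zero fun j hj => ?_).symm
      simp only [Finset.mem_filter] at hj
      obtain ⟨⟨h1, h2⟩, h3⟩ := hj
      rw [Fin.sum_univ_castSucc, h3] at h2
      simp only [Fin.val_last] at h2
      omega

theorem lieFlow_self {X : ℕ → LoopVectorField n} (hX : ∀ k, 1 ≤ k → IsLocalField False k (X k))
    {P : LoopOperator n} {d : ℕ} (hP : IsLocalOp False d P) (k : ℕ) :
    lieFlow X P k k = schurOperator X k P := lieFlow_eq hX hP k k (Nat.lt_succ_self k)

theorem lieExp_of_lt {X : Loop n → Loop n} {m k : ℕ} (hX : IsLocalField False m X)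
    (R : ℕ → LoopOperator n) (hk : k < m) : lieExp X m R k = R k := by
  rw [lieExp, Finset.sum_eq_single 0]
  · simp [lieTerm]
  · intro j _ hj
    rw [lieTerm, Pi.smul_apply, iterate_lieShift_eq hX, if_neg, smul_zero]
    have : m * 1 ≤ m * j := Nat.mul_le_mul_left m (by omega)
    omega
  · simp

theorem lieExp_self {X : Loop n → Loop n} {m : ℕ} (hX : IsLocalField False m X) (hm : 1 ≤ m)
    (R : ℕ → LoopOperator n) : lieExp X m R m = R m + lieDerivative X (R 0) := by
  rw [lieExp, ← Finset.sum_subset (s₁ := {0, 1})]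
  · rw [Finset.sum_pair (by omega)]
    simp [lieTerm, lieShift]
  · intro j hj
    simp only [Finset.mem_insert, Finset.mem_singleton, Finset.mem_range] at hj ⊢
    omega
  · intro j _ hj
    simp only [Finset.mem_insert, Finset.mem_singleton] at hj
    rw [lieTerm, Pi.smul_apply, iterate_lieShift_eq hX, if_neg, smul_zero]
    have : m * 2 ≤ m * j := Nat.mul_le_mul_left m (by omega)
    omega

/-- A sequence of bivectors satisfying the Jacobi identity is the flow of its leading term if the
second cohomology of the leading term vanishes in every degree. -/
theorem exists_lieFlow_eq {P : ℕ → LoopOperator n} (hP : IsBivectorSeq P)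
    (hJ : ∀ K u α β γ, seqBracket P P K u α β γ = 0)
    (hcoh : ∀ k Q, IsLocalOp False (k + 2) Q → IsSkew Q →
      (∀ u α β γ, triBracket (P 0) Q u α β γ = 0) →
      ∃ Y, IsLocalField False (k + 1) Y ∧ lieDerivative Y (P 0) = Q) :
    ∃ X : ℕ → LoopVectorField n, (∀ k, 1 ≤ k → IsLocalField False k (X k)) ∧
      ∀ k, P k = schurOperator X k (P 0) := by
  let Inv : ℕ → (ℕ → LoopOperator n) → Prop := fun k R => IsBivectorSeq R ∧
    (∀ K u α β γ, seqBracket R R K u α β γ = 0) ∧ ∀ j ≤ k, R j = P j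
  have step : ∀ k R, Inv k R → ∃ Y, IsLocalField False (k + 1) Y ∧ Inv (k + 1) (lieExp Y (k + 1) R) := by
    rintro k R ⟨hR, hRJ, hRP⟩
    have hR' : IsLocalOp False (k + 2) ((-1 : ℝ) • R (k + 1)) := (hR (k + 1)).1.smul (-1)
    obtain ⟨Y, hY, hYP⟩ := hcoh k (P (k + 1) + (-1 : ℝ) • R (k + 1))
      ((hP (k + 1)).1.add hR') ((hP (k + 1)).2.add ((hR (k + 1)).2.smul (-1)))
      (fun u α β γ => by
        rw [triBracket_comm, triBracket_add_left (hP (k + 1)).1 hR' (hP 0).1,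
          triBracket_smul_left (-1) (hR (k + 1)).1 (hP 0).1]
        have h1 := hJ (k + 1) u α β γ
        have h2 := hRJ (k + 1) u α β γ
        have e : ∀ f : ℕ × ℕ → ℝ, ∑ p ∈ Finset.HasAntidiagonal.antidiagonal (k + 1), f p =
            f (0, k + 1) + f (k + 1, 0) +
              ∑ p ∈ Finset.HasAntidiagonal.antidiagonal (k + 1) with p.1 ≤ k ∧ p.2 ≤ k, f p := by
          intro f
          rw [← Finset.sum_filter_add_sum_filter_not _ (fun p : ℕ × ℕ => p.1 ≤ k ∧ p.2 ≤ k),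
            add_comm]
          congr 1
          rw [← Finset.sum_pair (by simp)]
          refine Finset.sum_congr ?_ fun _ _ => rfl
          ext ⟨a, b⟩
          simp only [Finset.mem_filter, Finset.HasAntidiagonal.mem_antidiagonal, Finset.mem_insert,
            Finset.mem_singleton, Prod.mk.injEq]
          omega
        rw [seqBracket, e] at h1 h2
        have e2 : ∀ p ∈ (Finset.HasAntidiagonal.antidiagonal (k + 1)).filter
            (fun p : ℕ × ℕ => p.1 ≤ k ∧ p.2 ≤ k), triBracket (R p.1) (R p.2) u α β γ =
            triBracket (P p.1) (P p.2) u α β γ := fun p hp => by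
          obtain ⟨-, hp1, hp2⟩ := Finset.mem_filter.1 hp
          rw [hRP _ hp1, hRP _ hp2]
        rw [Finset.sum_congr rfl e2, hRP 0 (Nat.zero_le k)] at h2
        simp only [triBracket_comm (P 0)] at h1 h2
        linarith)
    refine ⟨Y, hY, hR.lieExp hY, seqBracket_lieExp hY (by omega) hR hRJ, fun j hj => ?_⟩
    rcases Nat.lt_or_ge j (k + 1) with h | h
    · rw [lieExp_of_lt hY R h, hRP j (by omega)]
    · obtain rfl : j = k + 1 := by omega
      rw [lieExp_self hY (by omega), hRP 0 (Nat.zero_le k), hYP]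
      module
  choose! Y hY hInv using step
  let st : ℕ → ℕ → LoopOperator n := fun k => Nat.rec (fun j => if j = 0 then P 0 else 0)
    (fun k R => lieExp (Y k R) (k + 1) R) k
  have hst : ∀ k, Inv k (st k) := by
    intro k
    induction k with
    | zero =>
      refine ⟨fun k => ?_, fun K u α β γ => ?_, fun j hj => ?_⟩
      · change IsLocalOp _ _ (if k = 0 then P 0 else 0) ∧ IsSkew (if k = 0 then P 0 else 0)
        split_ifs with h
        · exact h ▸ hP 0
        · exact ⟨isLocalOp_zero _, isSkew_zero⟩
      · refine Finset.sum_eq_zero fun p hp => ?_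
        change triBracket (if p.1 = 0 then P 0 else 0) (if p.2 = 0 then P 0 else 0) u α β γ = 0
        have h0 := hJ 0 u α β γ
        simp only [seqBracket, Finset.Nat.antidiagonal_zero, Finset.sum_singleton] at h0
        split_ifs
        · exact h0
        · rw [triBracket_comm]; exact triBracket_zero_left (hP 0).1 u α β γ
        · exact triBracket_zero_left (hP 0).1 u α β γ
        · exact triBracket_zero_left (isLocalOp_zero (E := False) 0) u α β γ
      · obtain rfl : j = 0 := by omega
        rfl
    | succ k ih => exact hInv k _ ih
  let X : ℕ → LoopVectorField n := fun k => Y (k - 1) (st (k - 1))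
  have hX : ∀ k, 1 ≤ k → IsLocalField False k (X k) := fun k hk =>
    (hY (k - 1) _ (hst _)).cast (by omega)
  have hflow : ∀ m, lieFlow X (P 0) m = st m := by
    intro m
    induction m with
    | zero => rfl
    | succ m ih => rw [lieFlow, ih]; rfl
  refine ⟨X, hX, fun k => ?_⟩
  rw [← lieFlow_self hX (hP 0).1, hflow, (hst k).2.2 k le_rfl]

end

section

variable {n : ℕ} {E : Prop} {d e k : ℕ} {X Y : Loop n → Loop n} {P Q R : Loop n → Loop n → Loop n}

/-! ## The derivative of loops and constant matrices -/

/-- The derivative of a loop. -/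
noncomputable def dLoop (α : Loop n) : Loop n := toLoop fun x a => jet α 1 a x

theorem dLoop_val (α : Loop n) (x : ℝ) (a : Fin n) : (dLoop α).1 x a = jet α 1 a x :=
  toLoop_apply (fun a => contDiff_jet α 1 a) (fun a => periodic_jet α 1 a) x a

theorem hasDerivAt_dLoop (α : Loop n) (x : ℝ) (a : Fin n) :
    HasDerivAt (fun y => α.1 y a) ((dLoop α).1 x a) x := by
  have h := hasDerivAt_jet α 0 a x
  rw [dLoop_val]
  rwa [show jet α 0 a = fun y => α.1 y a from funext fun y => jet_zero α a y] at h

theorem jet_dLoop (α : Loop n) (s : ℕ) (a : Fin n) (x : ℝ) :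
    jet (dLoop α) s a x = jet α (s + 1) a x := by
  have : (fun y => (dLoop α).1 y a) = deriv fun y => α.1 y a :=
    funext fun y => (hasDerivAt_dLoop α y a).deriv.symm
  rw [jet, this, jet, iteratedDeriv_succ']

theorem isLocalOp_dLoop : IsLocalOp E 1 (fun (_ : Loop n) α => dLoop α) := fun a =>
  (LForm.jet 1 a).congr fun _ φ x => (dLoop_val φ x a).symm

theorem dLoop_constLoop (c : Fin n → ℝ) : dLoop (constLoop c) = 0 :=
  Loop.ext' fun x a => by rw [dLoop_val, jet_constLoop_succ, Loop.zero_val]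

theorem pairing_dLoop_left (α β : Loop n) : loopPairing (dLoop α) β = -loopPairing α (dLoop β) := by
  have hi : ∀ (v w : Loop n) (a : Fin n), IntervalIntegrable (fun x => v.1 x a * w.1 x a)
      MeasureTheory.volume 0 1 := fun v w a =>
    ((Loop.continuous_coord v a).mul (Loop.continuous_coord w a)).intervalIntegrable _ _
  rw [loopPairing, loopPairing, intervalIntegral.integral_finsetSum fun a _ => hi _ _ a,
    intervalIntegral.integral_finsetSum fun a _ => hi _ _ a, ← Finset.sum_neg_distrib]
  refine Finset.sum_congr rfl fun a _ => ?_
  have h := integral_deriv_mul_periodic (contDiff_coord α a) (contDiff_coord β a)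
    (fun x => congrFun (α.2.2 x) a) (fun x => congrFun (β.2.2 x) a)
  simpa only [(hasDerivAt_dLoop _ _ a).deriv] using h

/-- Multiplication by a constant matrix. -/
noncomputable def matLoop (A : Matrix (Fin n) (Fin n) ℝ) (α : Loop n) : Loop n :=
  toLoop fun x a => ∑ b, A a b * α.1 x b

theorem matLoop_val (A : Matrix (Fin n) (Fin n) ℝ) (α : Loop n) (x : ℝ) (a : Fin n) :
    (matLoop A α).1 x a = ∑ b, A a b * α.1 x b :=
  toLoop_apply (fun a => ContDiff.sum fun b _ => contDiff_const.mul (contDiff_coord α b))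
    (fun a x => by simp only [α.2.2 x]) x a

theorem isLocalOp_matLoop (A : Matrix (Fin n) (Fin n) ℝ) :
    IsLocalOp E 0 (fun (_ : Loop n) α => matLoop A α) := fun a =>
  (LForm.sum Finset.univ fun b _ => (LForm.jet 0 b).const_mul (A a b)).congr fun _ φ x => by
    simp only [matLoop_val, jet_zero]

theorem matLoop_matLoop (A B : Matrix (Fin n) (Fin n) ℝ) (α : Loop n) :
    matLoop A (matLoop B α) = matLoop (A * B) α := Loop.ext' fun x a => by
  simp only [matLoop_val, Matrix.mul_apply, Finset.mul_sum, Finset.sum_mul, ← mul_assoc]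
  exact Finset.sum_comm

theorem matLoop_one (α : Loop n) : matLoop 1 α = α := Loop.ext' fun x a => by
  simp [matLoop_val, Matrix.one_apply]

theorem pairing_matLoop_left {A : Matrix (Fin n) (Fin n) ℝ} (hA : A.IsSymm) (α β : Loop n) :
    loopPairing (matLoop A α) β = loopPairing α (matLoop A β) := by
  simp only [loopPairing, matLoop_val, Finset.mul_sum, Finset.sum_mul]
  congr 1
  funext x
  rw [Finset.sum_comm]
  refine Finset.sum_congr rfl fun a _ => Finset.sum_congr rfl fun b _ => ?_
  rw [← hA.apply a b]
  ring

theorem dLoop_matLoop (A : Matrix (Fin n) (Fin n) ℝ) (α : Loop n) :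
    dLoop (matLoop A α) = matLoop A (dLoop α) := Loop.ext' fun x a => by
  have h : HasDerivAt (fun y => (matLoop A α).1 y a) (∑ b, A a b * (dLoop α).1 x b) x := by
    simp only [matLoop_val]
    exact HasDerivAt.fun_sum fun b _ => (hasDerivAt_dLoop α x b).const_mul (A a b)
  rw [matLoop_val, (hasDerivAt_dLoop _ x a).unique h]

theorem hydrodynamicOperator_apply (g : Matrix (Fin n) (Fin n) ℝ) (u α : Loop n) :
    hydrodynamicOperator g u α = matLoop g (dLoop α) := Loop.ext' fun x a => by
  rw [matLoop_val]
  simp only [← (hasDerivAt_dLoop α x _).deriv]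
  rfl

/-! ## Locality -/

theorem exists_dLoop_eq {φ : Loop n} (h : ∀ a, ∫ x in (0 : ℝ)..1, φ.1 x a = 0) :
    ∃ α, dLoop α = φ := by
  have hd : ∀ a x, HasDerivAt (fun y => ∫ t in (0 : ℝ)..y, φ.1 t a) (φ.1 x a) x := fun a x =>
    intervalIntegral.integral_hasDerivAt_right
      ((Loop.continuous_coord φ a).intervalIntegrable _ _)
      ((Loop.continuous_coord φ a).stronglyMeasurableAtFilter _ _) (Loop.continuous_coord φ a).continuousAt
  have hv := toLoop_apply (n := n) (f := fun x a => ∫ t in (0 : ℝ)..x, φ.1 t a)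
    (fun a => contDiff_infty_iff_deriv.2 ⟨fun x => (hd a x).differentiableAt, by
      rw [show deriv (fun y => ∫ t in (0 : ℝ)..y, φ.1 t a) = fun x => φ.1 x a from
        funext fun x => (hd a x).deriv]
      exact contDiff_coord φ a⟩)
    (fun a x => by
      have hp : Function.Periodic (fun x => φ.1 x a) 1 := fun x => congrFun (φ.2.2 x) a
      have h1 := hp.intervalIntegral_add_eq x 0
      rw [zero_add, h a] at h1
      have h2 := intervalIntegral.integral_add_adjacent_intervals
        (μ := MeasureTheory.volume) (a := 0) (b := x) (c := x + 1)
        ((Loop.continuous_coord φ a).intervalIntegrable _ _)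
        ((Loop.continuous_coord φ a).intervalIntegrable _ _)
      rw [h1, add_zero] at h2
      exact h2.symm)
  refine ⟨toLoop fun x a => ∫ t in (0 : ℝ)..x, φ.1 t a, Loop.ext' fun x a =>
    (hasDerivAt_dLoop _ x a).unique ?_⟩
  simp only [hv]
  exact hd a x

/-- A smooth periodic function equal to `1` near the integers and to `0` away from them. -/
noncomputable def periodicBump (x : ℝ) : ℝ :=
  Real.smoothTransition (4 * Real.cos (2 * Real.pi * x) - 2)

theorem contDiff_periodicBump : ContDiff ℝ ∞ periodicBump :=
  Real.smoothTransition.contDiff.comp (by fun_prop)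

theorem periodic_periodicBump : Function.Periodic periodicBump 1 := fun x => by
  rw [periodicBump, mul_add, mul_one, Real.cos_add_two_pi, periodicBump]

theorem periodicBump_eventually_eq_one :
    ∀ᶠ x in nhds (0 : ℝ), periodicBump x = 1 := by
  have hc : Continuous fun x : ℝ => 4 * Real.cos (2 * Real.pi * x) - 2 := by fun_prop
  have h0 : (1 : ℝ) < 4 * Real.cos (2 * Real.pi * 0) - 2 := by norm_num
  filter_upwards [hc.continuousAt.eventually (lt_mem_nhds h0)] with x hx
  exact Real.smoothTransition.one_of_one_le hx.le

theorem periodicBump_eventually_eq_zero {y : ℝ} (hy : Real.cos (2 * Real.pi * y) ≤ 0) :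
    ∀ᶠ x in nhds y, periodicBump x = 0 := by
  have hc : Continuous fun x : ℝ => 4 * Real.cos (2 * Real.pi * x) - 2 := by fun_prop
  have h0 : 4 * Real.cos (2 * Real.pi * y) - 2 < 0 := by linarith
  filter_upwards [hc.continuousAt.eventually (gt_mem_nhds h0)] with x hx
  exact Real.smoothTransition.zero_of_nonpos hx.le

/-- Every germ of a loop extends to the derivative of a loop that vanishes near the opposite
point. -/
theorem exists_dLoop_eventuallyEq (φ : Loop n) (x : ℝ) :
    ∃ α : Loop n, (∀ᶠ y in nhds x, (dLoop α).1 y = φ.1 y) ∧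
      ∀ᶠ y in nhds (x + 1 / 2), (dLoop α).1 y = (0 : Loop n).1 y := by
  set χ : ℝ → ℝ := fun y => periodicBump (y - x) with hχ
  set β : ℝ → ℝ := fun y => periodicBump (y - x - 1 / 4) with hβ
  have hχs : ContDiff ℝ ∞ χ := contDiff_periodicBump.comp (by fun_prop)
  have hβs : ContDiff ℝ ∞ β := contDiff_periodicBump.comp (by fun_prop)
  have hχp : Function.Periodic χ 1 := fun y => by
    simp only [hχ]; rw [← periodic_periodicBump (y - x)]; congr 1; ring
  have hβp : Function.Periodic β 1 := fun y => by
    simp only [hβ]; rw [← periodic_periodicBump (y - x - 1 / 4)]; congr 1; ring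
  have hpos : 0 < ∫ y in (0 : ℝ)..1, β y := by
    refine intervalIntegral.integral_pos one_pos hβs.continuous.continuousOn
      (fun y _ => Real.smoothTransition.nonneg _) ⟨Int.fract (x + 1 / 4),
        ⟨Int.fract_nonneg _, (Int.fract_lt_one _).le⟩, ?_⟩
    have h1 := hβp.sub_int_mul_eq ⌊x + 1 / 4⌋ (x := x + 1 / 4)
    rw [mul_one] at h1
    change 0 < β (x + 1 / 4 - ⌊x + 1 / 4⌋)
    rw [h1]
    simp only [hβ]
    rw [show x + 1 / 4 - x - 1 / 4 = 0 by ring, periodicBump_eventually_eq_one.self_of_nhds]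
    exact one_pos
  set m := ∫ y in (0 : ℝ)..1, β y
  set c : Fin n → ℝ := fun a => (∫ y in (0 : ℝ)..1, χ y * φ.1 y a) / m with hc
  have hv := toLoop_apply (n := n) (f := fun y a => χ y * φ.1 y a - c a * β y)
    (fun a => (hχs.mul (contDiff_coord φ a)).sub (contDiff_const.mul hβs))
    (fun a y => by
      change χ (y + 1) * φ.1 (y + 1) a - c a * β (y + 1) = χ y * φ.1 y a - c a * β y
      rw [hχp, hβp, φ.2.2])
  obtain ⟨α, hα⟩ := exists_dLoop_eq (φ := toLoop fun y a => χ y * φ.1 y a - c a * β y) (fun a => by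
    simp only [hv]
    rw [intervalIntegral.integral_sub, intervalIntegral.integral_const_mul]
    · simp only [hc]; field_simp; ring
    · exact (hχs.continuous.mul (Loop.continuous_coord φ a)).intervalIntegrable _ _
    · exact (continuous_const.mul hβs.continuous).intervalIntegrable _ _)
  have hev : ∀ (z w : ℝ) {p : ℝ → Prop}, (∀ᶠ y in nhds (z - w), p y) →
      ∀ᶠ y in nhds z, p (y - w) := fun z w p hp =>
    (by fun_prop : Continuous fun y : ℝ => y - w).continuousAt.eventually hp
  refine ⟨α, ?_, ?_⟩
  · have h1 := hev x x (p := fun y => periodicBump y = 1)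
      (by simpa using periodicBump_eventually_eq_one)
    have h2 := hev x (x + 1 / 4) (p := fun y => periodicBump y = 0)
      (periodicBump_eventually_eq_zero (by
        rw [show 2 * Real.pi * (x - (x + 1 / 4)) = -(Real.pi / 2) by ring, Real.cos_neg,
          Real.cos_pi_div_two]))
    filter_upwards [h1, h2] with y hy1 hy2
    funext a
    rw [hα, hv]
    simp only [hχ, hβ, hy1, sub_sub, hy2]
    ring
  · have h1 := hev (x + 1 / 2) x (p := fun y => periodicBump y = 0)
      (periodicBump_eventually_eq_zero (by
        rw [show 2 * Real.pi * (x + 1 / 2 - x) = Real.pi by ring, Real.cos_pi]; norm_num))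
    have h2 := hev (x + 1 / 2) (x + 1 / 4) (p := fun y => periodicBump y = 0)
      (periodicBump_eventually_eq_zero (by
        rw [show 2 * Real.pi * (x + 1 / 2 - (x + 1 / 4)) = Real.pi / 2 by ring,
          Real.cos_pi_div_two]))
    filter_upwards [h1, h2] with y hy1 hy2
    funext a
    rw [hα, hv]
    simp only [hχ, hβ, hy1, sub_sub, hy2, Loop.zero_val]
    ring

theorem dLoop_eq_zero {α : Loop n} (h : dLoop α = 0) (x y : ℝ) (a : Fin n) :
    α.1 x a = α.1 y a :=
  is_const_of_deriv_eq_zero (fun z => (hasDerivAt_dLoop α z a).differentiableAt)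
    (fun z => by rw [(hasDerivAt_dLoop α z a).deriv, h, Loop.zero_val]) x y

/-- A differential operator `N` with `d/dx ∘ N ∘ d/dx = 0` vanishes. -/
theorem IsLocalOp.eq_zero_of_dLoop (hP : IsLocalOp E d P) {u : Loop n}
    (h : ∀ α, dLoop (P u (dLoop α)) = 0) (φ : Loop n) : P u φ = 0 := by
  refine Loop.ext' fun x a => ?_
  obtain ⟨α, h1, h2⟩ := exists_dLoop_eventuallyEq φ x
  have e1 : (P u (dLoop α)).1 x a = (P u φ).1 x a := (hP a).congr_of_eventuallyEq u h1
  have e2 : (P u (dLoop α)).1 (x + 1 / 2) a = (P u 0).1 (x + 1 / 2) a :=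
    (hP a).congr_of_eventuallyEq u h2
  rw [← e1, dLoop_eq_zero (h α) x (x + 1 / 2) a, e2, hP.map_zero]
  rfl

theorem IsLocalField.eq_zero_of_dLoop (hX : IsLocalField False d X) (hd : d ≠ 0)
    (h : ∀ u, dLoop (X u) = 0) (u : Loop n) : X u = 0 := by
  have hX' : ∀ v φ, loopDeriv X v φ = 0 := fun v =>
    hX.deriv.eq_zero_of_dLoop fun α => by
      have h1 := (isLocalOp_dLoop (E := False)).loopDeriv_apply hX v (dLoop α)
      have h2 : operatorDeriv (fun (_ : Loop n) α => dLoop α) v (X v) (dLoop α) = 0 :=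
        loopDeriv_const _ _ _
      rw [h2, zero_add] at h1
      rw [← h1]
      simp only [h]
      exact loopDeriv_const 0 _ _
  refine Loop.ext' fun x a => ?_
  have h1 : ∀ t, HasDerivAt (fun s : ℝ => (X (0 + s • u)).1 x a) 0 t := fun t => by
    simpa only [hX', Loop.zero_val] using hX.hasDerivAt_line 0 u x a t
  have h2 := is_const_of_deriv_eq_zero (fun t => (h1 t).differentiableAt) (fun t => (h1 t).deriv) 1 0
  simp only [one_smul, zero_add, zero_smul] at h2
  rw [h2, (hX a).eq_zero_at_zero hd, Loop.zero_val]

/-! ## Division by the derivative -/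

theorem LForm.exists_div {L : Loop n → Loop n → ℝ → ℝ} {d : ℕ} (hL : LForm E d L) :
    ∀ k, d = k + 1 → ∃ (f : Fin n → Loop n → ℝ → ℝ) (M : Loop n → Loop n → ℝ → ℝ), LForm E k M ∧
      ∀ u φ x, L u φ x = ∑ b, f b u x * φ.1 x b + M u (dLoop φ) x := by
  induction hL with
  | @single d f hf s a =>
    intro k hk
    cases s with
    | zero =>
      refine ⟨fun b => if b = a then f else fun _ _ => 0, _, .zero k, fun u φ x => ?_⟩
      rw [Finset.sum_eq_single a (fun b _ hb => by simp [hb]) (by simp)]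
      simp [jet_zero]
    | succ s =>
      refine ⟨fun _ _ _ => 0, _, (LForm.single hf s a).cast (by omega), fun u φ x => ?_⟩
      simp [jet_dLoop]
  | zero d => exact fun k hk => ⟨fun _ _ _ => 0, _, .zero k, by simp⟩
  | add _ _ h1 h2 =>
    intro k hk
    obtain ⟨f, M, hM, h1⟩ := h1 k hk
    obtain ⟨g, N, hN, h2⟩ := h2 k hk
    refine ⟨fun b u x => f b u x + g b u x, _, hM.add hN, fun u φ x => ?_⟩
    simp only [h1, h2, add_mul, Finset.sum_add_distrib]
    ring

/-- The constant loops of the standard basis. -/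
def basisLoop (a : Fin n) : Loop n := constLoop (Pi.single a 1)

theorem dLoop_basisLoop (a : Fin n) : dLoop (basisLoop a) = 0 := dLoop_constLoop _

theorem basisLoop_val (a : Fin n) (x : ℝ) : (basisLoop a).1 x = Pi.single a 1 := rfl

theorem IsLocalOp.apply_basisLoop (hP : IsLocalOp E d P) (a : Fin n) :
    IsLocalField E d (fun u => P u (basisLoop a)) := hP.apply_const _

theorem IsLocalOp.exists_div (hP : IsLocalOp E (k + 1) P) (h : ∀ u a, P u (basisLoop a) = 0) :
    ∃ W : Loop n → Loop n → Loop n, IsLocalOp E k W ∧ ∀ u φ, P u φ = W u (dLoop φ) := by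
  choose f M hM hf using fun a => (hP a).exists_div k rfl
  obtain ⟨W, hW, hWv⟩ := exists_isLocalOp hM
  refine ⟨W, hW, fun u φ => Loop.ext' fun x a => ?_⟩
  have hz : ∀ b, f a b u x = 0 := fun b => by
    have h1 := hf a u (basisLoop b) x
    have h2 : M a u 0 x = 0 := by simpa using (hM a).map_smul 0 u 0 x
    rw [h, dLoop_basisLoop, h2, basisLoop_val] at h1
    simpa [Pi.single_apply] using h1.symm
  rw [hf, hWv]
  simp [hz]

/-! ## Averages along rays -/

/-- The integral `∫₀¹ tʲ X(t u) dt`. -/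
noncomputable def rayIntegral (j : ℕ) (X : Loop n → Loop n) (u : Loop n) : Loop n :=
  toLoop fun x a => ∫ t in (0 : ℝ)..1, t ^ j * (X (t • u)).1 x a

theorem IsLocalField.contDiff_rayTerm (hX : IsLocalField E d X) (j : ℕ) (u : Loop n) (a : Fin n) :
    ContDiff ℝ ∞ (fun p : ℝ × ℝ => p.1 ^ j * (X (p.1 • u)).1 p.2 a) :=
  (contDiff_fst.pow j).mul ((hX a).contDiff_ray u)

theorem IsLocalField.rayIntegral_val (hX : IsLocalField E d X) (j : ℕ) (u : Loop n) (x : ℝ)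
    (a : Fin n) :
    (rayIntegral j X u).1 x a = ∫ t in (0 : ℝ)..1, t ^ j * (X (t • u)).1 x a := by
  refine toLoop_apply (f := fun x a => ∫ t in (0 : ℝ)..1, t ^ j * (X (t • u)).1 x a)
    (fun a => ?_) (fun a x => ?_) x a
  · exact contDiff_integral_param (f := fun p : ℝ × ℝ => p.2 ^ j * (X (p.2 • u)).1 p.1 a)
      ((hX.contDiff_rayTerm j u a).comp (contDiff_snd.prodMk contDiff_fst))
  · simp only [(X _).2.2 x]

theorem IsLocalField.continuous_pairing_ray (hX : IsLocalField E d X) (u ψ : Loop n) :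
    Continuous fun t : ℝ => loopPairing (X (t • u)) ψ :=
  (contDiff_integral_param (f := fun p : ℝ × ℝ => ∑ a, (X (p.1 • u)).1 p.2 a * ψ.1 p.2 a)
    (ContDiff.sum fun a _ => ((hX a).contDiff_ray u).mul
      ((contDiff_coord ψ a).comp contDiff_snd))).continuous

theorem IsLocalField.pairing_rayIntegral (hX : IsLocalField E d X) (j : ℕ) (u ψ : Loop n) :
    loopPairing (rayIntegral j X u) ψ = ∫ t in (0 : ℝ)..1, t ^ j * loopPairing (X (t • u)) ψ := by
  have hc : ∀ a, Continuous fun p : ℝ × ℝ => p.2 ^ j * (X (p.2 • u)).1 p.1 a * ψ.1 p.1 a := fun a =>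
    ((hX.contDiff_rayTerm j u a).continuous.comp continuous_swap).mul
      ((Loop.continuous_coord ψ a).comp continuous_fst)
  have h1 : ∀ x, ∑ a, (rayIntegral j X u).1 x a * ψ.1 x a =
      ∫ t in (0 : ℝ)..1, ∑ a, t ^ j * (X (t • u)).1 x a * ψ.1 x a := fun x => by
    have hi : ∀ a ∈ Finset.univ, IntervalIntegrable
        (fun t : ℝ => t ^ j * (X (t • u)).1 x a * ψ.1 x a) MeasureTheory.volume 0 1 := fun a _ =>
      ((hc a).comp (by fun_prop : Continuous fun t : ℝ => (x, t))).intervalIntegrable _ _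
    rw [intervalIntegral.integral_finsetSum hi]
    simp only [hX.rayIntegral_val, intervalIntegral.integral_mul_const]
  simp only [loopPairing, h1]
  simp only [← intervalIntegral.integral_const_mul, Finset.mul_sum, ← mul_assoc]
  simp only [intervalIntegral.integral_of_le zero_le_one]
  refine MeasureTheory.integral_integral_swap ?_
  rw [MeasureTheory.Measure.prod_restrict]
  refine MeasureTheory.IntegrableOn.mono_set ?_
    (Set.prod_mono Set.Ioc_subset_Icc_self Set.Ioc_subset_Icc_self)
  exact (continuous_finsetSum _ fun a _ => hc a).continuousOn.integrableOn_compact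
    (isCompact_Icc.prod isCompact_Icc)

theorem isLocalField_rayIntegral (hX : IsLocalField False d X) (j : ℕ) :
    IsLocalField False d (rayIntegral j X) := fun a =>
  ((hX a).ray_integral j).congr fun u x => (hX.rayIntegral_val j u x a).symm

theorem LForm.ray_integral {L : Loop n → Loop n → ℝ → ℝ} (hL : LForm False d L) (j : ℕ) :
    LForm False d (fun u φ x => ∫ t in (0 : ℝ)..1, t ^ j * L (t • u) φ x) := by
  have hint : ∀ {d} {L : Loop n → Loop n → ℝ → ℝ}, LForm False d L → ∀ u φ x,
      IntervalIntegrable (fun t : ℝ => t ^ j * L (t • u) φ x) MeasureTheory.volume 0 1 :=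
    fun hL u φ x => ((continuous_id.pow j).mul
      (((hL.density φ).contDiff_ray u).comp_mk_left x).continuous).intervalIntegrable _ _
  induction hL with
  | single hf s a =>
    refine (LForm.single (hf.ray_integral j) s a).congr fun u φ x => ?_
    simp only [← intervalIntegral.integral_mul_const, mul_assoc]
  | zero d => exact (LForm.zero d).congr fun u φ x => by simp
  | add h1 h2 ih1 ih2 =>
    refine (ih1.add ih2).congr fun u φ x => ?_
    simp only [mul_add]
    exact (intervalIntegral.integral_add (hint h1 u φ x) (hint h2 u φ x)).symm

theorem isLocalOp_rayIntegral (hP : IsLocalOp False d P) (j : ℕ) :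
    IsLocalOp False d (fun u φ => rayIntegral j (fun v => P v φ) u) := fun a =>
  ((hP a).ray_integral j).congr fun u φ x => ((hP.apply_fixed φ).rayIntegral_val j u x a).symm

theorem IsLocalField.loopDeriv_rayIntegral (hX : IsLocalField E d X) (j : ℕ) (u φ : Loop n) :
    loopDeriv (rayIntegral j X) u φ = rayIntegral (j + 1) (fun v => loopDeriv X v φ) u := by
  refine loopDeriv_eq fun x a => ?_
  rw [(hX.deriv.apply_fixed φ).rayIntegral_val]
  simp only [hX.rayIntegral_val]
  refine hasDerivAt_integral_param
    (f := fun p : ℝ × ℝ => p.2 ^ j * (X (p.2 • (u + p.1 • φ))).1 x a) ?_ ?_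
  · refine (contDiff_snd.pow j).mul ((hX a).contDiff_comp (c := fun p : ℝ × ℝ =>
      p.2 • (u + p.1 • φ)) (y := fun _ => x) contDiff_const fun s b => ?_)
    simp only [jet_smul, jet_add]
    fun_prop
  · intro t
    have h := hX.hasDerivAt (t • u) (t • φ) x a
    rw [hX.deriv.map_smul, Loop.smul_val] at h
    have h2 : (fun s : ℝ => (X (t • (u + s • φ))).1 x a) =
        fun s : ℝ => (X (t • u + s • t • φ)).1 x a := by
      funext s; rw [smul_add, smul_comm]
    simp only [← h2] at h
    exact (h.const_mul (t ^ j)).congr_deriv (by ring)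

/-- The fundamental theorem of calculus along a ray. -/
theorem IsLocalField.rayIntegral_deriv (hX : IsLocalField E d X) (m : ℕ) (u : Loop n) :
    (m : ℝ) • rayIntegral (m - 1) X u + rayIntegral m (fun v => loopDeriv X v u) u =
      X u - (0 : ℝ) ^ m • X 0 := by
  refine Loop.ext' fun x a => ?_
  have hX' := hX.deriv.apply_fixed u
  have hd : ∀ t : ℝ, HasDerivAt (fun t : ℝ => t ^ m * (X (t • u)).1 x a)
      ((m : ℝ) * (t ^ (m - 1) * (X (t • u)).1 x a) + t ^ m * (loopDeriv X (t • u) u).1 x a) t :=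
    fun t => by
      have h := hX.hasDerivAt_line 0 u x a t
      simp only [zero_add] at h
      exact ((hasDerivAt_pow m t).mul h).congr_deriv (by ring)
  have hi1 : IntervalIntegrable (fun t : ℝ => (m : ℝ) * (t ^ (m - 1) * (X (t • u)).1 x a))
      MeasureTheory.volume 0 1 :=
    (continuous_const.mul ((hX.contDiff_rayTerm (m - 1) u a).comp_mk_left x).continuous).intervalIntegrable _ _
  have hi2 : IntervalIntegrable (fun t : ℝ => t ^ m * (loopDeriv X (t • u) u).1 x a)
      MeasureTheory.volume 0 1 :=
    ((hX'.contDiff_rayTerm m u a).comp_mk_left x).continuous.intervalIntegrable _ _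
  have := intervalIntegral.integral_eq_sub_of_hasDerivAt (fun t _ => hd t) (hi1.add hi2)
  rw [intervalIntegral.integral_add hi1 hi2, intervalIntegral.integral_const_mul] at this
  rw [Loop.add_val, Loop.smul_val, hX.rayIntegral_val, hX'.rayIntegral_val, this]
  simp

end

section

variable {n : ℕ} {E : Prop} {d e k : ℕ} {X Y : Loop n → Loop n} {P Q R : Loop n → Loop n → Loop n}
  {g : Matrix (Fin n) (Fin n) ℝ}

/-! ## The constant bivector of hydrodynamic type -/

/-- The value `g α'` of the constant bivector. -/
noncomputable def hydro (g : Matrix (Fin n) (Fin n) ℝ) (α : Loop n) : Loop n := matLoop g (dLoop α)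

theorem isLocalOp_hydro (g : Matrix (Fin n) (Fin n) ℝ) :
    IsLocalOp E 1 (fun (_ : Loop n) α => hydro g α) :=
  ((isLocalOp_matLoop g).comp isLocalOp_dLoop).cast (zero_add 1)

theorem hydrodynamicOperator_eq (g : Matrix (Fin n) (Fin n) ℝ) :
    hydrodynamicOperator g = fun _ α => hydro g α :=
  funext fun u => funext fun α => hydrodynamicOperator_apply g u α

theorem pairing_hydro_left (hs : g.IsSymm) (α β : Loop n) :
    loopPairing (hydro g α) β = -loopPairing α (hydro g β) := by
  rw [hydro, pairing_matLoop_left hs, pairing_dLoop_left, dLoop_matLoop, hydro]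

theorem isSkew_hydro (hs : g.IsSymm) : IsSkew (fun (_ : Loop n) α => hydro g α) :=
  fun _ => pairing_hydro_left hs

theorem hydro_basisLoop (g : Matrix (Fin n) (Fin n) ℝ) (a : Fin n) : hydro g (basisLoop a) = 0 := by
  rw [hydro, dLoop_basisLoop, (isLocalOp_matLoop (E := False) g).map_zero 0]

theorem operatorDeriv_hydro (u α φ : Loop n) :
    operatorDeriv (fun _ α => hydro g α) u α φ = 0 := loopDeriv_const _ _ _

theorem matLoop_inv_left (hr : IsUnit g.det) (α : Loop n) : matLoop g⁻¹ (matLoop g α) = α := by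
  rw [matLoop_matLoop, Matrix.nonsing_inv_mul g hr, matLoop_one]

theorem matLoop_inv_right (hr : IsUnit g.det) (α : Loop n) : matLoop g (matLoop g⁻¹ α) = α := by
  rw [matLoop_matLoop, Matrix.mul_nonsing_inv g hr, matLoop_one]

theorem IsLocalOp.eq_zero_of_hydro (hs : g.IsSymm) (hr : IsUnit g.det) (hP : IsLocalOp E d P)
    {u : Loop n} (h : ∀ α β, loopPairing (P u (hydro g α)) (hydro g β) = 0) (φ : Loop n) :
    P u φ = 0 := by
  have hN : IsLocalOp E (0 + (d + 0)) (fun u φ => matLoop g (P u (matLoop g φ))) :=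
    (isLocalOp_matLoop g).comp (hP.comp (isLocalOp_matLoop g))
  have h1 := hN.eq_zero_of_dLoop (u := u) (fun α => pairing_ext_left fun β => by
    rw [pairing_dLoop_left, pairing_matLoop_left hs, pairing_zero_left]
    exact neg_eq_zero.2 (h α β)) (matLoop g⁻¹ φ)
  rw [matLoop_inv_right hr] at h1
  rw [← matLoop_inv_left hr (P u φ), h1, (isLocalOp_matLoop (E := False) g⁻¹).map_zero 0]

theorem loopDeriv_hydro (hX : IsLocalField E d X) (u φ : Loop n) :
    loopDeriv (fun u => hydro g (X u)) u φ = hydro g (loopDeriv X u φ) := by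
  have h := (isLocalOp_hydro (E := E) g).loopDeriv_apply hX u φ
  rwa [operatorDeriv_hydro, zero_add] at h

theorem lieDerivative_hydro (X : Loop n → Loop n) (u α : Loop n) :
    lieDerivative X (fun _ α => hydro g α) u α =
      -loopDeriv X u (hydro g α) - hydro g (loopAdjoint (loopDeriv X u) α) := by
  rw [lieDerivative, operatorDeriv_hydro, zero_sub]

theorem triBracket_hydro (u α β γ : Loop n) (Q : LoopOperator n) :
    triBracket (fun _ α => hydro g α) Q u α β γ = triCyclic Q (fun _ α => hydro g α) u α β γ := by
  simp [triBracket, triCyclic, triTerm, operatorDeriv_hydro, pairing_zero_left]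

theorem triBracket_hydro_lieDerivative (hs : g.IsSymm) (hX : IsLocalField E k X) (u α β γ : Loop n) :
    triBracket (fun _ α => hydro g α) (lieDerivative X fun _ α => hydro g α) u α β γ = 0 := by
  have hz : ∀ u α β γ, triBracket (fun (_ : Loop n) α => hydro g α) (fun _ α => hydro g α)
      u α β γ = 0 := fun u α β γ => by
    simp [triBracket, triCyclic, triTerm, operatorDeriv_hydro, pairing_zero_left]
  have h := hasDerivAt_triBracket hX (isLocalOp_hydro g) (isLocalOp_hydro g) (isSkew_hydro hs)
    (isSkew_hydro hs) u α β γ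
  simp only [hz, add_zero] at h
  have h1 := h.unique (hasDerivAt_const _ _)
  rw [triBracket_comm] at h1
  linarith

/-! ## Symplectic vector fields are Hamiltonian -/

theorem exists_hydro_eq (hs : g.IsSymm) (hr : IsUnit g.det) (hY : IsLocalField False (k + 1) Y)
    (hsym : ∀ u α β, loopPairing (loopDeriv Y u (hydro g α)) β =
      loopPairing (loopDeriv Y u (hydro g β)) α) :
    ∃ ξ : Loop n → Loop n, IsLocalField False k ξ ∧ (∀ u, Y u = hydro g (ξ u)) ∧
      ∀ u φ ψ, loopPairing (loopDeriv ξ u φ) ψ = loopPairing (loopDeriv ξ u ψ) φ := by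
  have hB : ∀ u β, hydro g (loopAdjoint (loopDeriv Y u) β) = -loopDeriv Y u (hydro g β) :=
    fun u β => pairing_ext_right fun α => by
      rw [pairing_neg_right, pairing_comm α (loopDeriv Y u _), ← hsym, hY.deriv.pairing_adjoint,
        pairing_hydro_left hs, neg_neg]
  have hBe : ∀ u a, loopAdjoint (loopDeriv Y u) (basisLoop a) = 0 := fun u a =>
    (hY.deriv.adjoint.apply_basisLoop a).eq_zero_of_dLoop (by omega) (fun u => by
      have h := hB u (basisLoop a)
      rw [hydro_basisLoop, hY.deriv.map_zero, neg_zero, hydro] at h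
      rw [← matLoop_inv_left hr (dLoop _), h, (isLocalOp_matLoop (E := False) g⁻¹).map_zero 0]) u
  obtain ⟨W, hW, hWB⟩ := hY.deriv.adjoint.exists_div hBe
  have hYW : ∀ u φ, loopDeriv Y u φ = -hydro g (W u (matLoop g⁻¹ φ)) := fun u φ => by
    have hN : IsLocalOp False (k + 1) (fun u φ => loopDeriv Y u (matLoop g φ) + hydro g (W u φ)) :=
      (hY.deriv.comp (isLocalOp_matLoop g)).add
        (((isLocalOp_hydro g).comp hW).cast (add_comm _ _))
    have h := hN.eq_zero_of_dLoop (u := u) (fun α => by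
      rw [← hWB, hB]
      change dLoop (loopDeriv Y u (hydro g α) + _) = 0
      rw [add_neg_cancel, (isLocalOp_dLoop (E := False)).map_zero 0]) (matLoop g⁻¹ φ)
    rw [matLoop_inv_right hr] at h
    exact eq_neg_of_add_eq_zero_left h
  set ξ : Loop n → Loop n := fun u => -rayIntegral 0 (fun v => W v (matLoop g⁻¹ u)) u with hξ
  have hξf : IsLocalField False k ξ :=
    (((isLocalOp_rayIntegral hW 0).comp (isLocalOp_matLoop g⁻¹)).apply (e := 0) .id).neg
  have hYξ : ∀ u, Y u = hydro g (ξ u) := fun u => by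
    have h1 := hY.rayIntegral_deriv 0 u
    rw [Nat.cast_zero, zero_smul, zero_add, pow_zero, one_smul,
      show Y 0 = 0 from Loop.ext' fun x a => (hY a).eq_zero_at_zero (by omega) x, sub_zero] at h1
    rw [← h1]
    refine pairing_ext_left fun ψ => ?_
    rw [(hY.deriv.apply_fixed u).pairing_rayIntegral, hξ, pairing_hydro_left hs, pairing_neg_left,
      neg_neg, (hW.apply_fixed (matLoop g⁻¹ u)).pairing_rayIntegral]
    congr 1
    funext t
    rw [hYW, pairing_neg_left, pairing_hydro_left hs, neg_neg]
  refine ⟨ξ, hξf, hYξ, fun u φ ψ => ?_⟩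
  have hD : ∀ u φ, loopDeriv Y u φ = hydro g (loopDeriv ξ u φ) := fun u φ => by
    rw [← loopDeriv_hydro hξf, show Y = fun u => hydro g (ξ u) from funext hYξ]
  have h := (hξf.deriv.sub hξf.deriv.adjoint).eq_zero_of_hydro hs hr (u := u) (fun α β => by
    have h1 := hsym u α β
    rw [hD, hD, pairing_hydro_left hs, pairing_hydro_left hs] at h1
    rw [pairing_sub_left, pairing_comm (loopAdjoint _ _), ← hξf.deriv.pairing_adjoint]
    linarith) φ
  rw [sub_eq_zero] at h
  rw [h, pairing_comm, hξf.deriv.pairing_adjoint]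

/-- A field with selfadjoint derivative is the gradient of `∫ ⟨u, ∫₀¹ ξ(t u) dt⟩`. -/
theorem pairing_gradient (hX : IsLocalField E d X)
    (hsym : ∀ u φ ψ, loopPairing (loopDeriv X u φ) ψ = loopPairing (loopDeriv X u ψ) φ)
    (u φ : Loop n) :
    loopPairing φ (rayIntegral 0 X u) + loopPairing u (loopDeriv (rayIntegral 0 X) u φ) =
      loopPairing φ (X u) := by
  have h := hX.rayIntegral_deriv 1 u
  rw [Nat.cast_one, one_smul, pow_one, zero_smul, sub_zero] at h
  have h1 : loopPairing (rayIntegral (0 + 1) (fun v => loopDeriv X v φ) u) u =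
      loopPairing (rayIntegral 1 (fun v => loopDeriv X v u) u) φ := by
    rw [(hX.deriv.apply_fixed φ).pairing_rayIntegral, (hX.deriv.apply_fixed u).pairing_rayIntegral]
    simp only [hsym _ φ u]
  rw [hX.loopDeriv_rayIntegral, pairing_comm u, h1, ← h, pairing_add_right, pairing_comm φ
    (rayIntegral 1 _ _)]

/-- The values of a closed bivector on constant covectors are those of a Lie derivative. -/
theorem exists_lieDerivative_basisLoop (hs : g.IsSymm) (hr : IsUnit g.det)
    (hQ : IsLocalOp False (k + 1) Q) (hQs : IsSkew Q)
    (hc : ∀ u α β γ, triBracket (fun _ α => hydro g α) Q u α β γ = 0) :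
    ∃ X : Loop n → Loop n, IsLocalField False k X ∧
      ∀ u a, lieDerivative X (fun _ α => hydro g α) u (basisLoop a) = Q u (basisLoop a) := by
  have hsym : ∀ a u α β, loopPairing (loopDeriv (fun u => Q u (basisLoop a)) u (hydro g α)) β =
      loopPairing (loopDeriv (fun u => Q u (basisLoop a)) u (hydro g β)) α := fun a u α β => by
    have h := hc u α β (basisLoop a)
    rw [triBracket_hydro, triCyclic, triTerm, triTerm, triTerm, hydro_basisLoop,
      (hQ.opDeriv β).map_zero, pairing_zero_left, add_zero, hQ.skew_operatorDeriv hQs] at h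
    change loopPairing (operatorDeriv Q u (basisLoop a) _) _ =
      loopPairing (operatorDeriv Q u (basisLoop a) _) _
    linarith
  choose ξ hξ hQξ hξs using fun a => exists_hydro_eq hs hr (hQ.apply_basisLoop a) (hsym a)
  obtain ⟨X, hX, hXv⟩ := exists_isLocalField (E := False) (d := k)
    (f := fun a u x => -∑ b, u.1 x b * (rayIntegral 0 (ξ a) u).1 x b) (fun a =>
      (Density.sum _ fun b _ => ((IsLocalField.id (E := False) b).mul
        (isLocalField_rayIntegral (hξ a) 0 b)).cast (zero_add k)).neg)
  refine ⟨X, hX, fun u a => ?_⟩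
  have hadj : loopAdjoint (loopDeriv X u) (basisLoop a) = -ξ a u := loopAdjoint_eq fun φ => by
    have hXd : ∀ x, (loopDeriv X u φ).1 x a = -(∑ b, φ.1 x b * (rayIntegral 0 (ξ a) u).1 x b +
        ∑ b, u.1 x b * (loopDeriv (rayIntegral 0 (ξ a)) u φ).1 x b) := fun x => by
      refine (hX.hasDerivAt u φ x a).unique ?_
      simp only [hXv, ← Finset.sum_add_distrib]
      refine (HasDerivAt.fun_sum fun b _ => ?_).neg
      have h1 : HasDerivAt (fun s : ℝ => (u + s • φ).1 x b) (φ.1 x b) 0 := by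
        simpa using ((hasDerivAt_id (0 : ℝ)).mul_const (φ.1 x b)).const_add (u.1 x b)
      refine (h1.mul ((isLocalField_rayIntegral (hξ a) 0).hasDerivAt u φ x b)).congr_deriv ?_
      simp
    rw [pairing_neg_right, ← pairing_gradient (hξ a) (hξs a), loopPairing, loopPairing, loopPairing,
      ← intervalIntegral.integral_add (pairing_intervalIntegrable _ _)
        (pairing_intervalIntegrable _ _), ← intervalIntegral.integral_neg]
    congr 1
    funext x
    rw [← hXd]
    simp [basisLoop_val, Pi.single_apply]
  rw [lieDerivative_hydro, hydro_basisLoop, hX.deriv.map_zero, hadj, neg_zero, zero_sub, hQξ,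
    (isLocalOp_hydro (E := False) g).map_neg u, neg_neg]

/-! ## Closed bivectors vanishing on constant covectors -/

/-- A skewsymmetric operator that vanishes on constant covectors is `P₀ Ω P₀`. -/
theorem exists_hydro_conj (hs : g.IsSymm) (hr : IsUnit g.det) (hQ : IsLocalOp False (k + 2) Q)
    (hQs : IsSkew Q) (he : ∀ u a, Q u (basisLoop a) = 0) :
    ∃ Ω : LoopOperator n, IsLocalOp False k Ω ∧ IsSkew Ω ∧
      ∀ u α, Q u α = hydro g (Ω u (hydro g α)) := by
  obtain ⟨K, hK, hQK⟩ := hQ.exists_div he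
  have hKD : ∀ u β, dLoop (loopAdjoint (K u) β) = Q u β := fun u β =>
    pairing_ext_right fun α => by
      have h1 := hK.pairing_adjoint u (dLoop α) β
      rw [pairing_dLoop_left, ← hQK, hQs] at h1
      linarith
  obtain ⟨M, hM, hKM⟩ := hK.adjoint.exists_div fun u a =>
    (hK.adjoint.apply_basisLoop a).eq_zero_of_dLoop (by omega) (fun u => by rw [hKD, he]) u
  have hQM : ∀ u α, Q u α = -dLoop (loopAdjoint (M u) (dLoop α)) := fun u α =>
    pairing_ext_left fun β => by
      rw [hQK, hK.pairing_adjoint, hKM, pairing_neg_left,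
        pairing_dLoop_left (loopAdjoint _ _), neg_neg, pairing_comm (dLoop α), hM.pairing_adjoint,
        pairing_comm]
  have hΩ : IsLocalOp False k (fun u φ => -matLoop g⁻¹ (loopAdjoint (M u) (matLoop g⁻¹ φ))) :=
    (((isLocalOp_matLoop g⁻¹).comp (hM.adjoint.comp (isLocalOp_matLoop g⁻¹))).cast
      (zero_add k)).neg
  have hQΩ : ∀ u α, Q u α =
      hydro g (-matLoop g⁻¹ (loopAdjoint (M u) (matLoop g⁻¹ (hydro g α)))) := fun u α => by
    rw [hQM, hydro, hydro, matLoop_inv_left hr, ← dLoop_matLoop,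
      (isLocalOp_matLoop (E := False) g).map_neg 0, matLoop_inv_right hr,
      (isLocalOp_dLoop (E := False)).map_neg 0]
  refine ⟨_, hΩ, fun u φ ψ => ?_, hQΩ⟩
  have h := (hΩ.add hΩ.adjoint).eq_zero_of_hydro hs hr (u := u) (fun α β => by
    have h1 := hQs u α β
    rw [pairing_comm α, hQΩ, hQΩ, pairing_hydro_left hs, pairing_hydro_left hs] at h1
    rw [pairing_add_left, pairing_comm (loopAdjoint _ _), ← hΩ.pairing_adjoint]
    linarith) ψ
  rw [hΩ.pairing_adjoint, eq_neg_of_add_eq_zero_right h, pairing_neg_right]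

/-- The Poincaré lemma: `P₀ Ω P₀` is a Lie derivative of `P₀` if it is closed. -/
theorem exists_lieDerivative_conj (hs : g.IsSymm) (hr : IsUnit g.det) {Ω : LoopOperator n}
    (hΩ : IsLocalOp False k Ω) (hΩs : IsSkew Ω)
    (hc : ∀ u α β γ, triBracket (fun _ α => hydro g α)
      (fun u α => hydro g (Ω u (hydro g α))) u α β γ = 0) :
    ∃ X : Loop n → Loop n, IsLocalField False (k + 1) X ∧
      ∀ u α, lieDerivative X (fun _ α => hydro g α) u α = hydro g (Ω u (hydro g α)) := by
  have hskew := fun u φ α γ => hΩ.skew_operatorDeriv hΩs u φ α γ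
  have hclosed : ∀ u φ β γ, loopPairing (operatorDeriv Ω u φ (hydro g β)) (hydro g γ) +
      loopPairing (operatorDeriv Ω u (hydro g β) (hydro g γ)) φ +
      loopPairing (operatorDeriv Ω u (hydro g γ) φ) (hydro g β) = 0 := by
    intro u φ β γ
    have hN : IsLocalOp True k (fun u φ => operatorDeriv Ω u φ (hydro g β) -
        operatorDeriv Ω u (hydro g β) φ +
        loopAdjoint (operatorDeriv Ω u (hydro g β)) φ) :=
      (((hΩ.mono fun _ => trivial).operatorDeriv_along (IsLocalField.const (hydro g β) 0)).sub
        (hΩ.opDeriv _)).add (hΩ.opDeriv _).adjoint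
    have hNp : ∀ φ χ, loopPairing (operatorDeriv Ω u φ (hydro g β) -
        operatorDeriv Ω u (hydro g β) φ + loopAdjoint (operatorDeriv Ω u (hydro g β)) φ) χ =
        loopPairing (operatorDeriv Ω u φ (hydro g β)) χ +
        loopPairing (operatorDeriv Ω u (hydro g β) χ) φ +
        loopPairing (operatorDeriv Ω u χ φ) (hydro g β) := fun φ χ => by
      rw [pairing_add_left, pairing_sub_left, pairing_comm (loopAdjoint _ _),
        ← (hΩ.opDeriv (hydro g β)).pairing_adjoint, hskew u φ (hydro g β) χ]
      ring
    rw [← hNp, hN.eq_zero_of_hydro hs hr (u := u) (fun α γ => ?_) φ, pairing_zero_left]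
    have hd : ∀ α φ, operatorDeriv (fun u α => hydro g (Ω u (hydro g α))) u α φ =
        hydro g (operatorDeriv Ω u (hydro g α) φ) := fun α φ =>
      loopDeriv_hydro (hΩ.apply_fixed (hydro g α)) u φ
    have h := hc u α β γ
    rw [triBracket_hydro] at h
    simp only [triCyclic, triTerm, hd, pairing_hydro_left hs] at h
    rw [hNp]
    linarith
  have hR := isLocalOp_rayIntegral hΩ 1
  set θ : Loop n → Loop n := fun u => rayIntegral 1 (fun v => Ω v u) u with hθ
  have hθf : IsLocalField False k θ := hR.apply (e := 0) .id
  have hθd : ∀ u φ, loopDeriv θ u φ = rayIntegral 2 (fun v => operatorDeriv Ω v u φ) u +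
      rayIntegral 1 (fun v => Ω v φ) u := fun u φ => by
    rw [hθ, hR.loopDeriv_apply (IsLocalField.id (E := False)) u φ, loopDeriv_id]
    congr 1
    exact (hΩ.apply_fixed u).loopDeriv_rayIntegral 1 u φ
  have hθΩ : ∀ u α β, loopPairing (loopDeriv θ u (hydro g α)) (hydro g β) -
      loopPairing (loopDeriv θ u (hydro g β)) (hydro g α) =
      loopPairing (Ω u (hydro g α)) (hydro g β) := by
    intro u α β
    have h := (hΩ.apply_fixed (hydro g α)).rayIntegral_deriv 2 u
    rw [zero_pow two_ne_zero, zero_smul, sub_zero] at h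
    have h1 : loopPairing (rayIntegral 2 (fun v => operatorDeriv Ω v u (hydro g α)) u) (hydro g β) -
        loopPairing (rayIntegral 2 (fun v => operatorDeriv Ω v u (hydro g β)) u) (hydro g α) =
        loopPairing (rayIntegral 2 (fun v => operatorDeriv Ω v (hydro g α) u) u) (hydro g β) := by
      have hi : ∀ φ ψ χ, IntervalIntegrable (fun t : ℝ =>
          t ^ 2 * loopPairing (operatorDeriv Ω (t • u) φ ψ) χ) MeasureTheory.volume 0 1 := fun φ ψ χ =>
        ((continuous_id.pow 2).mul (((hΩ.opDeriv φ).apply_fixed ψ).continuous_pairing_ray u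
          χ)).intervalIntegrable _ _
      rw [((hΩ.opDeriv u).apply_fixed _).pairing_rayIntegral,
        ((hΩ.opDeriv u).apply_fixed _).pairing_rayIntegral,
        ((hΩ.opDeriv (hydro g α)).apply_fixed _).pairing_rayIntegral,
        ← intervalIntegral.integral_sub (hi _ _ _) (hi _ _ _)]
      congr 1
      funext t
      have e1 := hclosed (t • u) u α β
      rw [hskew _ _ (hydro g α) u, hskew _ _ (hydro g β) (hydro g α)] at e1
      linear_combination t ^ 2 * e1
    have h2 : loopPairing (rayIntegral 1 (fun v => Ω v (hydro g β)) u) (hydro g α) =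
        -loopPairing (rayIntegral 1 (fun v => Ω v (hydro g α)) u) (hydro g β) := by
      rw [(hΩ.apply_fixed _).pairing_rayIntegral, (hΩ.apply_fixed _).pairing_rayIntegral,
        ← intervalIntegral.integral_neg]
      congr 1
      funext t
      rw [hΩs, pairing_comm]
      ring
    rw [hθd, hθd, ← h, pairing_add_left, pairing_add_left, pairing_add_left, pairing_smul_left, h2]
    change _ = _ + loopPairing (rayIntegral 2 (fun v => operatorDeriv Ω v (hydro g α) u) u) _
    rw [← h1]
    push_cast
    ring
  have hX : IsLocalField False (k + 1) (fun u => -hydro g (θ u)) :=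
    (((isLocalOp_hydro g).apply hθf).cast (add_comm _ _)).neg
  have hXd : ∀ u φ, loopDeriv (fun u => -hydro g (θ u)) u φ = -hydro g (loopDeriv θ u φ) :=
    fun u φ => by
      rw [((isLocalOp_hydro g).apply hθf).loopDeriv_neg, loopDeriv_hydro hθf]
  refine ⟨_, hX, fun u α => pairing_ext_left fun β => ?_⟩
  have h := hθΩ u α β
  rw [lieDerivative_hydro, pairing_sub_left, pairing_neg_left, pairing_hydro_left hs (loopAdjoint _ _),
    pairing_comm (loopAdjoint _ _), ← hX.deriv.pairing_adjoint, hXd, hXd, pairing_neg_left,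
    pairing_neg_left, pairing_hydro_left hs, pairing_hydro_left hs, pairing_hydro_left hs]
  linarith

/-- Vanishing of the second cohomology of `P₀` in positive degrees. -/
theorem exists_lieDerivative_eq (hs : g.IsSymm) (hr : IsUnit g.det)
    (hQ : IsLocalOp False (k + 2) Q) (hQs : IsSkew Q)
    (hc : ∀ u α β γ, triBracket (fun _ α => hydro g α) Q u α β γ = 0) :
    ∃ X : Loop n → Loop n, IsLocalField False (k + 1) X ∧
      lieDerivative X (fun _ α => hydro g α) = Q := by
  obtain ⟨X, hX, hXe⟩ := exists_lieDerivative_basisLoop hs hr hQ hQs hc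
  have hL : IsLocalOp False (k + 2) (lieDerivative X fun _ α => hydro g α) :=
    (isLocalOp_lieDerivative hX (isLocalOp_hydro g)).cast (by ring)
  have hLs := isSkew_lieDerivative hX (isLocalOp_hydro g) (isSkew_hydro hs)
  have hL' : IsLocalOp False (k + 2) ((-1 : ℝ) • lieDerivative X fun _ α => hydro g α) :=
    hL.smul (-1)
  obtain ⟨Ω, hΩ, hΩs, hQΩ⟩ := exists_hydro_conj hs hr (hQ.add hL') (hQs.add (hLs.smul (-1)))
    fun u a => by
      simp only [Pi.smul_apply, hXe]
      module
  have hQΩ' : Q + (-1 : ℝ) • lieDerivative X (fun _ α => hydro g α) =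
      fun u α => hydro g (Ω u (hydro g α)) := funext fun u => funext fun α => hQΩ u α
  obtain ⟨Y, hY, hYΩ⟩ := exists_lieDerivative_conj hs hr hΩ hΩs fun u α β γ => by
    rw [← hQΩ', triBracket_comm, triBracket_add_left hQ hL' (isLocalOp_hydro (E := False) g),
      triBracket_smul_left _ hL (isLocalOp_hydro (E := False) g), triBracket_comm, hc, triBracket_comm,
      triBracket_hydro_lieDerivative hs hX]
    ring
  refine ⟨fun u => X u + Y u, hX.add hY, funext fun u => funext fun α => ?_⟩
  have h1 := hYΩ u α
  rw [← hQΩ] at h1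
  have h2 : lieDerivative (fun u => X u + Y u) (fun _ α => hydro g α) u α =
      lieDerivative X (fun _ α => hydro g α) u α + lieDerivative Y (fun _ α => hydro g α) u α := by
    rw [lieDerivative_hydro, lieDerivative_hydro, lieDerivative_hydro, hX.loopDeriv_add hY,
      loopAdjoint_add hX hY, (isLocalOp_hydro (E := False) g).map_add u]
    abel
  rw [h2, h1, Pi.smul_apply, Pi.smul_apply]
  module

/-! ## Homogeneous deformations -/

theorem IsHomogeneousOperator.isLocalOp (hP : IsHomogeneousOperator d P) : IsLocalOp False d P := by
  obtain ⟨A, hA, hPA⟩ := hP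
  intro a
  refine (LForm.sum (Finset.range (d + 1)) fun l hl => LForm.sum Finset.univ fun b _ =>
    (LForm.single ((hA l a b).density False) (d - l) b).cast ?_).congr
    fun u φ x => (hPA u φ x a).symm
  rw [Finset.mem_range] at hl
  omega

theorem IsLocalField.isHomogeneousVectorField (hX : IsLocalField False d X) :
    IsHomogeneousVectorField d X := by
  choose f hf hXf using fun a => (hX a).exists_diffPoly
  exact ⟨f, hf, fun u x a => hXf a u x⟩

theorem mainTheorem3 (n : ℕ) (g : Matrix (Fin n) (Fin n) ℝ) (hsymm : g.IsSymm)
    (hreg : IsUnit g.det) (P : ℕ → LoopOperator n) (hP : IsHomogeneousDeformation g P) :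
    ∃ X : ℕ → LoopVectorField n,
      (∀ k : ℕ, 1 ≤ k → IsHomogeneousVectorField k (X k)) ∧
      ∀ k : ℕ, P k = schurOperator X k (P 0) := by
  have hseq : IsBivectorSeq P := fun k => ⟨(hP.homogeneous k).isLocalOp, hP.skew k⟩
  obtain ⟨X, hX, hXP⟩ := exists_lieFlow_eq hseq (fun K u α β γ => by
      have h := congrFun (congrFun (congrFun (hP.jacobi K) u) α) β
      simp only [Finset.sum_apply, Pi.zero_apply] at h
      have h1 := congrArg (fun v => 2 * loopPairing v γ) h
      simp only [pairing_sum_left, Finset.mul_sum, pairing_zero_left, mul_zero] at h1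
      rw [seqBracket, ← h1]
      exact Finset.sum_congr rfl fun p _ => (two_mul_pairing_schoutenBracket (hseq p.1).1
        (hseq p.2).1 (hseq p.1).2 (hseq p.2).2 u α β γ).symm)
    fun k Q hQ hQs hc => by
      rw [hP.zero, hydrodynamicOperator_eq] at hc ⊢
      exact exists_lieDerivative_eq hsymm hreg hQ hQs hc
  exact ⟨X, fun k hk => (hX k hk).isHomogeneousVectorField, hXP⟩

end
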